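/- Let $n\ge 0$, $m\ge 2$, and write $[r]=\{1,\dots,r\}$. For $i\in[m]$ let $f_i:\mathbb{R}^n\to(-\infty,+\infty]$ be proper, lower semicontinuous and convex, and let $g_i:\mathbb{R}^n\to\mathbb{R}$ be convex and differentiable with $\frac1{\beta_i}$-Lipschitz gradient, where $\beta_i\in(0,\infty]$ and $\frac1\infty=0$. Put $\Phi=\sum_{i=1}^m(f_i+g_i)$. Assume that $\Phi$ has a minimizer and that $\bigcap_{i=1}^m\mathrm{ri}(\mathrm{dom} f_i)\ne\emptyset$. Let $\sigma\in[0,1]$, let $\alpha_i\ge0$ with $\alpha_i+\lfloor1-\sigma\rfloor\ne0$ for $i\in[m-1]$, and let $\gamma>0$ and $\lambda_i$ satisfy, for all $i\in[m-1]$, $$\gamma<\frac{2\alpha_i}{\frac1{\beta_m(m-1)}+\frac{\sigma}{\beta_i}},\qquad \gamma<\frac{2(2+\alpha_i)}{(1-\sigma)\frac1{\beta_i}},\qquad 0<\lambda_i<2+\alpha_i-\frac{(1-\sigma)\gamma}{2\beta_i},$$ where $\frac r0=\infty$ for every real $r\ge 0$ (also for $r=0$). For $f$ proper, lower semicontinuous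 and convex, let $\mathrm{prox}_f(v)$ be the unique minimizer of $u\mapsto f(u)+\frac12\|u-v\|^2$. On a probability space $(\Omega,\mathcal F,\mathbb P)$, let $S_k\subseteq[m-1]$ ($k\ge0$) be random sets. Given deterministic $y_i^0,z_i^0\in\mathbb{R}^n$, $i\in[m-1]$, let the infinite S-D-RSM sequence satisfy, for every $k\ge0$, $$x^{k+1}=\mathrm{prox}_{\frac{\gamma f_m}{m-1}}\Big(\tfrac1{m-1}\sum_{i=1}^{m-1}\big(z_i^k+\alpha_i(y_i^k-x^{k+1})-\tfrac{\gamma}{m-1}\nabla g_m(y_i^k)\big)-\tfrac{\sigma\gamma}{m-1}\sum_{i=1}^{m-1}\nabla g_i(y_i^k)\Big);$$ for $i\in S_k$, $$y_i^{k+1}=\mathrm{prox}_{\gamma f_i}\big(2x^{k+1}-z_i^k+\alpha_i(x^{k+1}-y_i^{k+1})-(1-\sigma)\gamma\nabla g_i(x^{k+1})\big),\qquad z_i^{k+1}=z_i^k+\lambda_i(y_i^{k+1}-x^{k+1});$$ and $y_i^{k+1}=y_i^k$, $z_i^{k+1}=z_i^k$ for $i\in[m-1]\setminus S_k$. For all $k\ge0$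 and $i\in[m-1]$ define $\tilde y_i^{k+1}$ by $$\tilde y_i^{k+1}=\mathrm{prox}_{\gamma f_i}\big(2x^{k+1}-z_i^k+\alpha_i(x^{k+1}-\tilde y_i^{k+1})-(1-\sigma)\gamma\nabla g_i(x^{k+1})\big).$$ Assume that, for every $k$, $S_k$ is independent of $\mathcal F_k=\sigma\big(\{y_i^j,z_i^j: 0\le j\le k,\ i\in[m-1]\}\big)$, and that $\mathbb P(i\in S_k)=p_i>0$ for all $i\in[m-1]$, with $p_i$ not depending on $k$. Then, for every $i\in[m-1]$, almost surely $$\lim_{k\to\infty}\|x^{k+1}-y_i^k\|=\lim_{k\to\infty}\|x^k-\tilde y_i^k\|=0,$$ and there is a random variable $\tilde x$ with values in $\arg\min\Phi$ such that $x^k\to\tilde x$ almost surely. -/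

import Mathlib

open MeasureTheory ProbabilityTheory Filter Topology

/-- `f : ℝⁿ → (-∞, +∞]` is proper, lower semicontinuous and convex (the class `Γ₀(ℝⁿ)`). -/
structure IsGammaZero {n : ℕ} (f : EuclideanSpace ℝ (Fin n) → EReal) : Prop where
  ne_bot : ∀ x, f x ≠ ⊥
  exists_ne_top : ∃ x, f x ≠ ⊤
  lsc : LowerSemicontinuous f
  convex : ∀ x y : EuclideanSpace ℝ (Fin n), ∀ a b : ℝ, 0 < a → 0 < b → a + b = 1 →
    f (a • x + b • y) ≤ (a : EReal) * f x + (b : EReal) * f y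

/-- The effective domain of an extended-real-valued function. -/
def effDom {n : ℕ} (f : EuclideanSpace ℝ (Fin n) → EReal) : Set (EuclideanSpace ℝ (Fin n)) :=
  {x | f x ≠ ⊤}

/-- The set of minimizers over the whole space. -/
def argminSet {n : ℕ} (F : EuclideanSpace ℝ (Fin n) → EReal) : Set (EuclideanSpace ℝ (Fin n)) :=
  {x | ∀ y, F x ≤ F y}

/-- `p = prox_{c f}(v)`, that is, `p` is a minimizer of `u ↦ c f(u) + ½ ‖u - v‖²`
(for `f ∈ Γ₀(ℝⁿ)` and `c > 0` the minimizer exists and is unique). -/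
def IsProx {n : ℕ} (c : ℝ) (f : EuclideanSpace ℝ (Fin n) → EReal)
    (v p : EuclideanSpace ℝ (Fin n)) : Prop :=
  p ∈ argminSet (fun u => (c : EReal) * f u + ((1 / 2 * ‖u - v‖ ^ 2 : ℝ) : EReal))

/-- The composite objective `Φ(x) = ∑ᵢ (fᵢ(x) + gᵢ(x))` over all nodes. -/
noncomputable def objective {n M : ℕ} (f : Fin M → EuclideanSpace ℝ (Fin n) → EReal)
    (g : Fin M → EuclideanSpace ℝ (Fin n) → ℝ) (x : EuclideanSpace ℝ (Fin n)) : EReal :=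
  ∑ i, (f i x + (g i x : EReal))

/-- Standing assumptions on the data of `min Φ`: each `fᵢ` is in `Γ₀(ℝⁿ)`, each `gᵢ` is convex and
differentiable with `Lᵢ`-Lipschitz gradient (`Lᵢ = 1/βᵢ`, where `Lᵢ = 0` stands for `βᵢ = ∞`),
a minimizer exists, and the relative interiors of the domains of the `fᵢ` have a common point. -/
structure IsProblem {n M : ℕ} (f : Fin M → EuclideanSpace ℝ (Fin n) → EReal)
    (g : Fin M → EuclideanSpace ℝ (Fin n) → ℝ) (L : Fin M → NNReal) : Prop where
  gammaZero : ∀ i, IsGammaZero (f i)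
  convex : ∀ i, ConvexOn ℝ Set.univ (g i)
  differentiable : ∀ i, Differentiable ℝ (g i)
  lipschitz : ∀ i, LipschitzWith (L i) (gradient (g i))
  exists_min : (argminSet (objective f g)).Nonempty
  ri_inter : (⋂ i, intrinsicInterior ℝ (effDom (f i))).Nonempty

/-- Parameter ranges. There are `N = m - 1` users `Fin.castSucc i`, and the server is the last node
`Fin.last N`. A bound `r / s` on `γ` is imposed only if `s ≠ 0`, because of the convention
`r / 0 = ∞`. -/
structure IsAdmissible {N : ℕ} (L : Fin (N + 1) → NNReal) (σ γ : ℝ) (α lam : Fin N → ℝ) :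
    Prop where
  sigma_mem : σ ∈ Set.Icc (0 : ℝ) 1
  alpha_nonneg : ∀ i, 0 ≤ α i
  alpha_floor : ∀ i, α i + (⌊1 - σ⌋ : ℝ) ≠ 0
  gamma_pos : 0 < γ
  gamma_lt_one : ∀ i : Fin N,
    (L (Fin.last N) : ℝ) / N + σ * L i.castSucc ≠ 0 →
      γ < 2 * α i / ((L (Fin.last N) : ℝ) / N + σ * L i.castSucc)
  gamma_lt_two : ∀ i : Fin N,
    (1 - σ) * L i.castSucc ≠ 0 → γ < 2 * (2 + α i) / ((1 - σ) * L i.castSucc)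
  lam_mem : ∀ i : Fin N,
    lam i ∈ Set.Ioo (0 : ℝ) (2 + α i - (1 - σ) * γ * L i.castSucc / 2)

/-- The argument of the server's proximal step; `w` is the new server iterate itself. -/
noncomputable def serverArg {n N : ℕ} (g : Fin (N + 1) → EuclideanSpace ℝ (Fin n) → ℝ) (σ γ : ℝ)
    (α : Fin N → ℝ) (y z : Fin N → EuclideanSpace ℝ (Fin n)) (w : EuclideanSpace ℝ (Fin n)) :
    EuclideanSpace ℝ (Fin n) :=
  (1 / (N : ℝ)) • ∑ i : Fin N,
      (z i + α i • (y i - w) - (γ / N) • gradient (g (Fin.last N)) (y i))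
    - (σ * γ / N) • ∑ i : Fin N, gradient (g i.castSucc) (y i)

/-- The argument of a user's proximal step; `w` is the new user iterate itself. -/
noncomputable def userArg {n : ℕ} (g : EuclideanSpace ℝ (Fin n) → ℝ) (σ γ a : ℝ)
    (x z w : EuclideanSpace ℝ (Fin n)) : EuclideanSpace ℝ (Fin n) :=
  (2 : ℝ) • x - z + a • (x - w) - ((1 - σ) * γ) • gradient g x

/-- `x, y, z` is the (infinite) trajectory generated by S-D-RSM from the initial points `y0, z0`
when the user set selected in iteration `k` is `S k`. The value `x 0` is not used. -/
structure IsSDRSM {n N : ℕ} (f : Fin (N + 1) → EuclideanSpace ℝ (Fin n) → EReal)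
    (g : Fin (N + 1) → EuclideanSpace ℝ (Fin n) → ℝ) (σ γ : ℝ) (α lam : Fin N → ℝ)
    (y0 z0 : Fin N → EuclideanSpace ℝ (Fin n)) (S : ℕ → Finset (Fin N))
    (x : ℕ → EuclideanSpace ℝ (Fin n)) (y z : ℕ → Fin N → EuclideanSpace ℝ (Fin n)) : Prop where
  init_y : y 0 = y0
  init_z : z 0 = z0
  server : ∀ k, IsProx (γ / N) (f (Fin.last N)) (serverArg g σ γ α (y k) (z k) (x (k + 1)))
    (x (k + 1))
  user_y : ∀ k, ∀ i ∈ S k, IsProx γ (f i.castSucc)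
    (userArg (g i.castSucc) σ γ (α i) (x (k + 1)) (z k i) (y (k + 1) i)) (y (k + 1) i)
  user_z : ∀ k, ∀ i ∈ S k, z (k + 1) i = z k i + lam i • (y (k + 1) i - x (k + 1))
  idle_y : ∀ k, ∀ i ∉ S k, y (k + 1) i = y k i
  idle_z : ∀ k, ∀ i ∉ S k, z (k + 1) i = z k i

/-- `yt (k + 1) i` is the virtual update of user `i`, computed as if user `i` had been selected in
iteration `k`. The value `yt 0` is not used. -/
def IsVirtual {n N : ℕ} (f : Fin (N + 1) → EuclideanSpace ℝ (Fin n) → EReal)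
    (g : Fin (N + 1) → EuclideanSpace ℝ (Fin n) → ℝ) (σ γ : ℝ) (α : Fin N → ℝ)
    (x : ℕ → EuclideanSpace ℝ (Fin n)) (z yt : ℕ → Fin N → EuclideanSpace ℝ (Fin n)) : Prop :=
  ∀ k i, IsProx γ (f i.castSucc)
    (userArg (g i.castSucc) σ γ (α i) (x (k + 1)) (z k i) (yt (k + 1) i)) (yt (k + 1) i)

/-- The history `𝓕ₖ = σ({yʲ, zʲ : j ≤ k})`. -/
@[reducible] def history {Ω : Type*} {n N : ℕ} (y z : ℕ → Ω → Fin N → EuclideanSpace ℝ (Fin n)) (k : ℕ) :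
    MeasurableSpace Ω :=
  ⨆ j ∈ Set.Iic k, (MeasurableSpace.comap (y j) inferInstance ⊔
    MeasurableSpace.comap (z j) inferInstance)

/-- Random sampling: `S k` is a random set that is independent of `𝓕ₖ`, and user `i` is selected
with probability `p i > 0` in each iteration. -/
structure IsSampling {Ω : Type*} [MeasurableSpace Ω] {n N : ℕ} (P : Measure Ω)
    (S : ℕ → Ω → Finset (Fin N)) (p : Fin N → ℝ)
    (y z : ℕ → Ω → Fin N → EuclideanSpace ℝ (Fin n)) : Prop where
  measurable : ∀ k i, MeasurableSet {ω | i ∈ S k ω}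
  indep : ∀ k, Indep (MeasurableSpace.comap (S k) ⊤) (history y z k) P
  prob : ∀ k i, P.real {ω | i ∈ S k ω} = p i
  pos : ∀ i, 0 < p i

/-! Each proximal step is an inclusion: a vector built from the current data is a subgradient of the
corresponding $f_i$. A stationary pair $(x^*,z^*)$ solves the same inclusions with all $y_i=x^*$.
Adding these inclusions cancels the $z_i^*$ and leaves the optimality condition for $\Phi$.
Conversely, Fermat's rule with the relative-interior sum rule turns any minimizer into a stationary
pair.

Monotonicity of the subdifferentials, tested between an iterate and a stationary pair, together with
cocoercivity of the gradients gives `IsFixedPair.sum_userLyapunov_le`. If all users were updated,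
$\sum_i\big(\|z_i-z_i^*\|^2/(2\lambda_i)+\frac{\alpha_i}2\|y_i-x^*\|^2\big)$ would drop by a
nonnegative combination of $\|x-y_i\|^2$ and $\|x-\tilde y_i\|^2$. Weighting user $i$ by $1/p_i$
makes the expected drop under random selection equal to this full drop. Robbins–Siegmund then gives,
almost surely, convergence of the Lyapunov function and vanishing residuals.

To have one null set for all stationary pairs, a countable dense set of them is used. An Opial-type
argument (`exists_isFixedPair_tendsto`) then identifies a cluster point and shows that the whole
sequence $x^k$ converges to it.

If $\alpha_i=0$ the residual need not control $\|x-y_i\|$. There $y_i^k\to\tilde x$ follows because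
$y_i$ is almost surely refreshed by the convergent sequence $\tilde y_i$ again and again
(`ae_frequently_refreshed`).

Measurability is cheap: $y^0,z^0$ are deterministic and there are finitely many users, so the state
$(y^k,z^k)$ takes finitely many values, and $x^{k+1},\tilde y^{k+1}$ are functions of it. -/

/-! ### Convex duality: the subdifferential sum rule -/

section Subgradients

variable {E : Type*} [NormedAddCommGroup E] [InnerProductSpace ℝ E]

/-- An affine-plus-quadratic lower bound near `0` forces the linear coefficient to be nonnegative. -/
theorem nonneg_of_forall_linear_add_sq {A B : ℝ}
    (h : ∀ t : ℝ, 0 < t → t < 1 → 0 ≤ t * A + t ^ 2 * B) : 0 ≤ A := by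
  have hlim : Tendsto (fun t : ℝ => A + t * B) (𝓝[>] 0) (𝓝 A) := by
    have : Continuous fun t : ℝ => A + t * B := by fun_prop
    simpa using (this.tendsto 0).mono_left nhdsWithin_le_nhds
  refine ge_of_tendsto hlim ?_
  filter_upwards [Ioo_mem_nhdsGT (zero_lt_one' ℝ)] with t ht
  have := h t ht.1 ht.2
  rw [show t * A + t ^ 2 * B = t * (A + t * B) by ring] at this
  exact nonneg_of_mul_nonneg_right this ht.1

/-- A point of the relative interior can be moved a little in every direction of the affine span. -/
theorem eventually_add_smul_mem_of_mem_intrinsicInterior {D : Set E} {a v : E}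
    (ha : a ∈ intrinsicInterior ℝ D) (hv : v ∈ (affineSpan ℝ D).direction) :
    ∀ᶠ ε in 𝓝[>] (0 : ℝ), a + ε • v ∈ D := by
  obtain ⟨a', ha', rfl⟩ := ha
  have hmem : ∀ ε : ℝ, (a' : E) + ε • v ∈ affineSpan ℝ D := fun ε => by
    have := AffineSubspace.vadd_mem_of_mem_direction
      ((affineSpan ℝ D).direction.smul_mem ε hv) a'.2
    rwa [vadd_eq_add, add_comm] at this
  let φ : ℝ → affineSpan ℝ D := fun ε => ⟨(a' : E) + ε • v, hmem ε⟩
  have hφ : Continuous φ := by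
    refine Continuous.subtype_mk ?_ _
    fun_prop
  have h0 : φ 0 = a' := by ext; simp [φ]
  have : ∀ᶠ ε in 𝓝 (0 : ℝ), φ ε ∈ ((↑) : affineSpan ℝ D → E) ⁻¹' D := by
    apply hφ.continuousAt.eventually
    rw [h0]
    exact mem_interior_iff_mem_nhds.1 ha'
  exact this.filter_mono nhdsWithin_le_nhds

/-- Fermat's rule together with the subdifferential sum rule in finite dimension, under the
relative-interior qualification. -/
theorem exists_subgradients_sum_eq [FiniteDimensional ℝ E] {ι : Type*} [Fintype ι]
    {D : ι → Set E} {F : ι → E → ℝ} (hF : ∀ i, ConvexOn ℝ (D i) (F i)) {a x₀ : E}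
    (ha : ∀ i, a ∈ intrinsicInterior ℝ (D i)) (hx₀ : ∀ i, x₀ ∈ D i) (c : E)
    (hmin : ∀ q, (∀ i, q ∈ D i) → ∑ i, F i x₀ ≤ ∑ i, F i q + inner ℝ c (q - x₀)) :
    ∃ u : ι → E, (∀ i, ∀ q ∈ D i, F i x₀ + inner ℝ (u i) (q - x₀) ≤ F i q) ∧ ∑ i, u i = -c := by
  classical
  -- Perturbations $w$ that, after a common shift $d$, point along the affine spans of the $D_i$; on
  -- these the relative-interior point makes the perturbed problem feasible.
  let W : Submodule ℝ (ι → E) :=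
    { carrier := {w | ∃ d : E, ∀ i, w i + d ∈ (affineSpan ℝ (D i)).direction}
      add_mem' := by
        rintro w w' ⟨d, hd⟩ ⟨d', hd'⟩
        refine ⟨d + d', fun i => ?_⟩
        have := add_mem (hd i) (hd' i)
        rwa [add_add_add_comm] at this
      zero_mem' := ⟨0, fun i => by simp⟩
      smul_mem' := by
        rintro r w ⟨d, hd⟩
        refine ⟨r • d, fun i => ?_⟩
        have := Submodule.smul_mem _ r (hd i)
        rwa [smul_add] at this }
  -- The cone generated by the epigraph of the value function $v(w)=\inf_x\sum_i F_i(x+w_i)+\langle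
  -- c,x-x_0\rangle-\sum_i F_i(x_0)$. A linear minorant of $v$ has the desired $u_i$ as components.
  let s : ConvexCone ℝ (W × ℝ) :=
    { carrier := {p | ∃ r : ℝ, 0 < r ∧ ∃ x : E, (∀ i, x + r • (p.1 : ι → E) i ∈ D i) ∧
        ∑ i, F i (x + r • (p.1 : ι → E) i) + inner ℝ c (x - x₀) - ∑ i, F i x₀ ≤ r * p.2}
      smul_mem' := by
        rintro b hb p ⟨r, hr, x, hx, hle⟩
        have hp : ∀ i, (r / b) • ((b • p).1 : ι → E) i = r • (p.1 : ι → E) i := fun i => by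
          simp [smul_smul, hb.ne']
        refine ⟨r / b, by positivity, x, fun i => by rw [hp]; exact hx i, ?_⟩
        simp only [hp]
        refine hle.trans_eq ?_
        simp only [Prod.smul_snd, smul_eq_mul]
        field_simp
      add_mem' := by
        rintro p ⟨r, hr, x, hx, hle⟩ p' ⟨r', hr', x', hx', hle'⟩
        have hrr : 0 < r + r' := by positivity
        set b := r' / (r + r') with hb
        set b' := r / (r + r') with hb'
        have hb0 : 0 ≤ b := by positivity
        have hb0' : 0 ≤ b' := by positivity
        have hbb : b + b' = 1 := by rw [hb, hb']; field_simp; ring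
        have e1 : b * r = r * r' / (r + r') := by rw [hb]; ring
        have e2 : b' * r' = r * r' / (r + r') := by rw [hb']; ring
        have hpt : ∀ i, (b • x + b' • x') + (r * r' / (r + r')) • ((p + p').1 : ι → E) i =
            b • (x + r • (p.1 : ι → E) i) + b' • (x' + r' • (p'.1 : ι → E) i) := fun i => by
          simp only [Prod.fst_add, Submodule.coe_add, Pi.add_apply, smul_add, smul_smul, e1, e2]
          abel
        refine ⟨r * r' / (r + r'), by positivity, b • x + b' • x', fun i => ?_, ?_⟩
        · rw [hpt]
          exact (hF i).1 (hx i) (hx' i) hb0 hb0' hbb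
        · simp only [hpt]
          have h1 : ∑ i, F i (b • (x + r • (p.1 : ι → E) i) + b' • (x' + r' • (p'.1 : ι → E) i)) ≤
              b * ∑ i, F i (x + r • (p.1 : ι → E) i) +
                b' * ∑ i, F i (x' + r' • (p'.1 : ι → E) i) := by
            rw [Finset.mul_sum, Finset.mul_sum, ← Finset.sum_add_distrib]
            exact Finset.sum_le_sum fun i _ => (hF i).2 (hx i) (hx' i) hb0 hb0' hbb
          have h2 : inner ℝ c (b • x + b' • x' - x₀) =
              b * inner ℝ c (x - x₀) + b' * inner ℝ c (x' - x₀) := by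
            have : b • x + b' • x' - x₀ = b • (x - x₀) + b' • (x' - x₀) := by
              have : x₀ = b • x₀ + b' • x₀ := by rw [← add_smul, hbb, one_smul]
              nth_rewrite 1 [this]
              simp only [smul_sub]
              abel
            rw [this, inner_add_right, inner_smul_right, inner_smul_right]
          have h3 := mul_le_mul_of_nonneg_left hle hb0
          have h4 := mul_le_mul_of_nonneg_left hle' hb0'
          have h5 : r * r' / (r + r') * (p + p').2 = b * (r * p.2) + b' * (r' * p'.2) := by
            rw [← mul_assoc, ← mul_assoc, e1, e2, Prod.snd_add]; ring
          rw [h2, h5]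
          have h6 : ∑ i, F i x₀ = b * ∑ i, F i x₀ + b' * ∑ i, F i x₀ := by
            rw [← add_mul, hbb, one_mul]
          linarith }
  have hs0 : s.Pointed := by
    refine ⟨1, one_pos, x₀, fun i => ?_, ?_⟩
    · simpa using hx₀ i
    · simp
  let f : (W × ℝ) →ₗ.[ℝ] ℝ :=
    { domain := LinearMap.ker (LinearMap.fst ℝ W ℝ)
      toFun := (LinearMap.snd ℝ W ℝ).comp (Submodule.subtype _) }
  -- Minimality of $x_0$ says $v(0)\ge0$, so $(0,t)\mapsto t$ is nonnegative on the cone. Finiteness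
  -- of $v$ at a small multiple of every $w$, obtained by starting from $a$, is the richness that
  -- the extension needs.
  obtain ⟨φ, hφf, hφs⟩ := riesz_extension (s.toPointedCone hs0) f
    (by
      rintro ⟨p, hp⟩ ⟨r, hr, x, hx, hle⟩
      have hp0 : p.1 = 0 := hp
      change 0 ≤ p.2
      simp only [hp0, Submodule.coe_zero, Pi.zero_apply, smul_zero, add_zero] at hx hle
      have := hmin x hx
      exact nonneg_of_mul_nonneg_right (by linarith) hr)
    (by
      rintro ⟨⟨w, d, hd⟩, t⟩
      have hev : ∀ᶠ ε in 𝓝[>] (0 : ℝ), ∀ i, a + ε • (w i + d) ∈ D i :=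
        Filter.eventually_all.2 fun i =>
          eventually_add_smul_mem_of_mem_intrinsicInterior (ha i) (hd i)
      obtain ⟨ε, hε, hε0⟩ := (hev.and self_mem_nhdsWithin).exists
      have hε0 : 0 < ε := hε0
      have hpt : ∀ i, a + ε • d + ε • w i = a + ε • (w i + d) := fun i => by
        rw [smul_add]; abel
      let T := (∑ i, F i (a + ε • (w i + d)) + inner ℝ c (a + ε • d - x₀) - ∑ i, F i x₀) / ε
      refine ⟨⟨(0, T - t), rfl⟩, ε, hε0, a + ε • d, fun i => ?_, ?_⟩
      · simp only [Prod.mk_add_mk, zero_add, hpt]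
        exact hε i
      · simp only [Prod.mk_add_mk, zero_add, hpt, sub_add_cancel, T]
        rw [mul_div_cancel₀ _ hε0.ne'])
  have hφ1 : ∀ t : ℝ, φ (0, t) = t := fun t => hφf ⟨(0, t), rfl⟩
  obtain ⟨ψ, hψ⟩ := LinearMap.exists_extend (-(φ.comp (LinearMap.inl ℝ W ℝ)))
  have hψs : ∀ p : W × ℝ, p ∈ s → ψ (p.1 : ι → E) ≤ p.2 := fun p hp => by
    have h1 : ψ (p.1 : ι → E) = -φ (p.1, 0) := by
      have := LinearMap.congr_fun hψ p.1
      simpa using this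
    have h2 : φ p = φ (p.1, 0) + p.2 := by
      rw [← hφ1 p.2, ← map_add]
      simp
    have := hφs p hp
    linarith
  let u : ι → E := fun i => (InnerProductSpace.toDual ℝ E).symm
    (LinearMap.toContinuousLinearMap (ψ.comp (LinearMap.single ℝ (fun _ => E) i)))
  have hu : ∀ i d, inner ℝ (u i) d = ψ (Pi.single i d) := fun i d => by
    simp [u]
  have husum : ∀ w : ι → E, ψ w = ∑ i, inner ℝ (u i) (w i) := fun w => by
    conv_lhs => rw [← Finset.univ_sum_single w]
    rw [map_sum]
    exact Finset.sum_congr rfl fun i _ => (hu i _).symm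
  refine ⟨u, fun i q hq => ?_, ?_⟩
  · have hmem : (Pi.single i (q - x₀) : ι → E) ∈ W := by
      refine ⟨0, fun j => ?_⟩
      rw [add_zero]
      rcases eq_or_ne j i with rfl | hj
      · rw [Pi.single_eq_same]
        exact AffineSubspace.vsub_mem_direction (subset_affineSpan _ _ hq)
          (subset_affineSpan _ _ (hx₀ j))
      · rw [Pi.single_eq_of_ne hj]; exact zero_mem _
    have hpt : ∀ j, x₀ + (1 : ℝ) • (Pi.single i (q - x₀) : ι → E) j = Function.update
        (fun _ => x₀) i q j := fun j => by
      rcases eq_or_ne j i with rfl | hj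
      · simp
      · simp [hj]
    have := hψs (⟨_, hmem⟩, F i q - F i x₀) ⟨1, one_pos, x₀, fun j => ?_, ?_⟩
    · simp only [← hu] at this
      linarith
    · simp only [hpt]
      rcases eq_or_ne j i with rfl | hj
      · simpa using hq
      · simpa [hj] using hx₀ j
    · simp only [hpt]
      have : ∑ j, F j (Function.update (fun _ => x₀) i q j) - ∑ j, F j x₀ = F i q - F i x₀ := by
        rw [← Finset.sum_sub_distrib, Finset.sum_eq_single i]
        · simp
        · intro j _ hj; simp [hj]
        · simp
      simp
      linarith
  -- Shifting $x_0$ by $d$ and perturbing every component by $-d$ leaves all the $F_i$ values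
  -- unchanged, so only the linear term is seen.
  · have hle : ∀ d : E, 0 ≤ inner ℝ (∑ i, u i + c) d := fun d => by
      have hmem : (fun _ => -d : ι → E) ∈ W := ⟨d, fun i => by simp⟩
      have := hψs (⟨_, hmem⟩, inner ℝ c d) ⟨1, one_pos, x₀ + d, fun j => ?_, ?_⟩
      · rw [husum] at this
        simp only [inner_neg_right, Finset.sum_neg_distrib] at this
        rw [inner_add_left, sum_inner]
        linarith
      · simpa using hx₀ j
      · simp
    have h1 := hle (-(∑ i, u i + c))
    rw [inner_neg_right, real_inner_self_eq_norm_sq] at h1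
    have : ‖∑ i, u i + c‖ = 0 := by nlinarith [norm_nonneg (∑ i, u i + c)]
    exact eq_neg_of_add_eq_zero_left (norm_eq_zero.1 this)

end Subgradients

/-! ### Convex functions with Lipschitz gradient -/

section SmoothConvex

variable {E : Type*} [NormedAddCommGroup E] [InnerProductSpace ℝ E] [CompleteSpace E]

/-- The quadratic upper bound for a function with Lipschitz gradient. -/
theorem le_add_inner_add_sq_of_lipschitz_gradient {g : E → ℝ} {g' : E → E} {L : ℝ}
    (hg : ∀ x, HasGradientAt g (g' x) x) (hL : ∀ x y, ‖g' x - g' y‖ ≤ L * ‖x - y‖) (p q : E) :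
    g q ≤ g p + inner ℝ (g' p) (q - p) + L / 2 * ‖q - p‖ ^ 2 := by
  set d := q - p with hd
  let φ : ℝ → ℝ := fun t => g (p + t • d) - t * inner ℝ (g' p) d - L / 2 * t ^ 2 * ‖d‖ ^ 2
  have hφ : ∀ t, HasDerivAt φ (inner ℝ (g' (p + t • d)) d - inner ℝ (g' p) d - L * t * ‖d‖ ^ 2) t :=
    fun t => by
      have h1 : HasDerivAt (fun t : ℝ => p + t • d) d t := by
        simpa using ((hasDerivAt_id t).smul_const d).const_add p
      have h2 := (hg (p + t • d)).hasFDerivAt.comp_hasDerivAt t h1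
      have h3 : HasDerivAt (fun t : ℝ => t * inner ℝ (g' p) d) (inner ℝ (g' p) d) t := by
        simpa using (hasDerivAt_id t).mul_const (inner ℝ (g' p) d)
      have h4 : HasDerivAt (fun t : ℝ => L / 2 * t ^ 2 * ‖d‖ ^ 2) (L * t * ‖d‖ ^ 2) t := by
        refine (((hasDerivAt_pow 2 t).const_mul (L / 2)).mul_const (‖d‖ ^ 2)).congr_deriv ?_
        rw [show 2 - 1 = 1 from rfl]
        push_cast
        ring
      have := (h2.sub h3).sub h4
      rw [InnerProductSpace.toDual_apply_apply] at this
      exact this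
  have hanti : AntitoneOn φ (Set.Icc 0 1) := by
    refine antitoneOn_of_deriv_nonpos (convex_Icc 0 1)
      (fun t _ => (hφ t).continuousAt.continuousWithinAt)
      (fun t _ => (hφ t).differentiableAt.differentiableWithinAt) fun t ht => ?_
    rw [interior_Icc] at ht
    rw [(hφ t).deriv, ← inner_sub_left]
    have h1 := real_inner_le_norm (g' (p + t • d) - g' p) d
    have h2 := hL (p + t • d) p
    rw [add_sub_cancel_left, norm_smul, Real.norm_of_nonneg ht.1.le] at h2
    nlinarith [norm_nonneg d]
  have := hanti (Set.left_mem_Icc.2 zero_le_one) (Set.right_mem_Icc.2 zero_le_one) zero_le_one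
  simp only [φ, zero_smul, one_smul, add_zero, hd, add_sub_cancel] at this
  simp only [hd]
  linarith

theorem ConvexOn.add_inner_gradient_le {g : E → ℝ} {g' : E → E} {L : ℝ}
    (hc : ConvexOn ℝ Set.univ g) (hg : ∀ x, HasGradientAt g (g' x) x)
    (hL : ∀ x y, ‖g' x - g' y‖ ≤ L * ‖x - y‖) (p q : E) :
    g p + inner ℝ (g' p) (q - p) ≤ g q := by
  suffices 0 ≤ g q - g p - inner ℝ (g' p) (q - p) by linarith
  refine nonneg_of_forall_linear_add_sq (B := L / 2 * ‖q - p‖ ^ 2) fun t ht0 ht1 => ?_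
  -- The quadratic upper bound for $-g$ bounds $g$ from below to second order, so dividing the
  -- convexity inequality by $t$ gives the gradient inequality.
  have h1 := le_add_inner_add_sq_of_lipschitz_gradient (g := -g) (g' := fun x => -g' x) (L := L)
    (fun x => by
      rw [hasGradientAt_iff_hasFDerivAt, map_neg]
      exact (hg x).hasFDerivAt.neg)
    (fun x y => by rw [neg_sub_neg, norm_sub_rev]; exact hL x y) p (p + t • (q - p))
  have h2 := hc.2 (Set.mem_univ p) (Set.mem_univ q) (sub_nonneg.2 ht1.le) ht0.le
    (sub_add_cancel 1 t)
  have h3 : (1 - t) • p + t • q = p + t • (q - p) := by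
    rw [sub_smul, one_smul, smul_sub]; abel
  rw [h3] at h2
  simp only [Pi.neg_apply, add_sub_cancel_left, inner_neg_left, inner_smul_right, norm_smul,
    Real.norm_of_nonneg ht0.le, mul_pow, smul_eq_mul] at h1 h2
  nlinarith

/-- The Baillon–Haddad inequality. -/
theorem ConvexOn.norm_gradient_sub_sq_le {g : E → ℝ} {g' : E → E} {L : ℝ}
    (hc : ConvexOn ℝ Set.univ g) (hg : ∀ x, HasGradientAt g (g' x) x) (hL0 : 0 ≤ L)
    (hL : ∀ x y, ‖g' x - g' y‖ ≤ L * ‖x - y‖) (p q : E) :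
    ‖g' p - g' q‖ ^ 2 ≤ L * inner ℝ (g' p - g' q) (p - q) := by
  rcases hL0.eq_or_lt with rfl | hL0
  · have := hL p q
    rw [zero_mul] at this ⊢
    nlinarith [norm_nonneg (g' p - g' q)]
  -- The tangent bound from $q$ and the quadratic bound from $p$ are compared at $p-L^{-1}\delta$,
  -- the point where their gap is extremal. Adding the two versions with $p,q$ exchanged gives
  -- cocoercivity.
  have key : ∀ p q : E, g q + inner ℝ (g' q) (p - q) + ‖g' p - g' q‖ ^ 2 / (2 * L) ≤ g p := by
    intro p q
    set δ := g' p - g' q with hδ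
    have h1 := hc.add_inner_gradient_le hg hL q (p - L⁻¹ • δ)
    have h2 := le_add_inner_add_sq_of_lipschitz_gradient hg hL p (p - L⁻¹ • δ)
    have h3 : inner ℝ (g' q) (p - L⁻¹ • δ - q) =
        inner ℝ (g' q) (p - q) - L⁻¹ * inner ℝ (g' q) δ := by
      rw [sub_right_comm, inner_sub_right, inner_smul_right]
    have h4 : inner ℝ (g' p) δ - inner ℝ (g' q) δ = ‖δ‖ ^ 2 := by
      rw [← inner_sub_left, ← hδ, real_inner_self_eq_norm_sq]
    have h5 : L / 2 * (L⁻¹ * ‖δ‖) ^ 2 = ‖δ‖ ^ 2 / (2 * L) := by field_simp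
    have h6 : L⁻¹ * ‖δ‖ ^ 2 = 2 * (‖δ‖ ^ 2 / (2 * L)) := by field_simp
    rw [h3] at h1
    rw [sub_sub_cancel_left, inner_neg_right, inner_smul_right, norm_neg, norm_smul,
      Real.norm_of_nonneg (inv_nonneg.2 hL0.le), h5] at h2
    have h7 : L⁻¹ * inner ℝ (g' p) δ - L⁻¹ * inner ℝ (g' q) δ = L⁻¹ * ‖δ‖ ^ 2 := by
      rw [← mul_sub, h4]
    linarith
  have h1 := key p q
  have h2 := key q p
  rw [norm_sub_rev, ← neg_sub p q, inner_neg_right] at h2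
  have h3 : ‖g' p - g' q‖ ^ 2 = L * (2 * (‖g' p - g' q‖ ^ 2 / (2 * L))) := by field_simp
  rw [h3]
  refine mul_le_mul_of_nonneg_left ?_ hL0.le
  rw [inner_sub_left]
  linarith

/-- The three-point consequence of cocoercivity. -/
theorem ConvexOn.neg_sq_le_inner_gradient_sub {g : E → ℝ} {g' : E → E} {L : ℝ}
    (hc : ConvexOn ℝ Set.univ g) (hg : ∀ x, HasGradientAt g (g' x) x) (hL0 : 0 ≤ L)
    (hL : ∀ x y, ‖g' x - g' y‖ ≤ L * ‖x - y‖) (y x q : E) :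
    -(L / 4 * ‖x - y‖ ^ 2) ≤ inner ℝ (g' y - g' q) (x - q) := by
  rcases hL0.eq_or_lt with rfl | hL0
  · have := hL y q
    rw [zero_mul] at this
    rw [norm_eq_zero.1 (le_antisymm this (norm_nonneg _))]
    simp
  have h1 := hc.norm_gradient_sub_sq_le hg hL0.le hL y q
  have h2 : inner ℝ (g' y - g' q) (x - q) =
      inner ℝ (g' y - g' q) (y - q) + inner ℝ (g' y - g' q) (x - y) := by
    rw [← inner_add_right]; congr 1; abel
  have h3 := neg_le_of_abs_le (abs_real_inner_le_norm (g' y - g' q) (x - y))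
  rw [h2]
  -- By cocoercivity the right side is at least $(\|g'(y)-g'(q)\|-\frac L2\|x-y\|)^2$.
  have h4 : 0 ≤ L * (inner ℝ (g' y - g' q) (y - q) + inner ℝ (g' y - g' q) (x - y) +
      L / 4 * ‖x - y‖ ^ 2) := by
    nlinarith [sq_nonneg (‖g' y - g' q‖ - L / 2 * ‖x - y‖)]
  linarith [nonneg_of_mul_nonneg_right h4 hL0]

end SmoothConvex

/-! ### Subgradients of extended-real-valued functions and proximal points -/

section ExtendedReal

variable {n : ℕ}

/-- `u` is a subgradient of `f` at `p`, expressed with real values on the effective domain. -/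
def IsSubgradient (f : EuclideanSpace ℝ (Fin n) → EReal) (p u : EuclideanSpace ℝ (Fin n)) : Prop :=
  p ∈ effDom f ∧ ∀ q ∈ effDom f, (f p).toReal + inner ℝ u (q - p) ≤ (f q).toReal

theorem IsSubgradient.inner_nonneg {f : EuclideanSpace ℝ (Fin n) → EReal}
    {p u p' u' : EuclideanSpace ℝ (Fin n)} (h : IsSubgradient f p u) (h' : IsSubgradient f p' u') :
    0 ≤ inner ℝ (u - u') (p - p') := by
  have h1 := h.2 p' h'.1
  have h2 := h'.2 p h.1
  rw [← neg_sub p p', inner_neg_right] at h1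
  rw [inner_sub_left]
  linarith

namespace IsGammaZero

variable {f : EuclideanSpace ℝ (Fin n) → EReal}

theorem coe_toReal (hf : IsGammaZero f) {x : EuclideanSpace ℝ (Fin n)} (hx : x ∈ effDom f) :
    ((f x).toReal : EReal) = f x :=
  EReal.coe_toReal hx (hf.ne_bot x)

theorem convexOn_toReal (hf : IsGammaZero f) : ConvexOn ℝ (effDom f) fun x => (f x).toReal := by
  have key : ∀ x ∈ effDom f, ∀ y ∈ effDom f, ∀ a b : ℝ, 0 < a → 0 < b → a + b = 1 →
      f (a • x + b • y) ≤ ((a * (f x).toReal + b * (f y).toReal : ℝ) : EReal) := by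
    intro x hx y hy a b ha hb hab
    have := hf.convex x y a b ha hb hab
    rw [← hf.coe_toReal hx, ← hf.coe_toReal hy] at this
    exact_mod_cast this
  have hmem : ∀ x ∈ effDom f, ∀ y ∈ effDom f, ∀ a b : ℝ, 0 < a → 0 < b → a + b = 1 →
      a • x + b • y ∈ effDom f := fun x hx y hy a b ha hb hab =>
    ((key x hx y hy a b ha hb hab).trans_lt (EReal.coe_lt_top _)).ne
  refine convexOn_iff_forall_pos.2 ⟨convex_iff_forall_pos.2 fun x hx y hy a b ha hb hab =>
    hmem x hx y hy a b ha hb hab, fun x hx y hy a b ha hb hab => ?_⟩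
  have := key x hx y hy a b ha hb hab
  rw [← hf.coe_toReal (hmem x hx y hy a b ha hb hab)] at this
  exact EReal.coe_le_coe_iff.1 this

/-- Compare the proximal objective at $p$ and at $p+t(q-p)$, use convexity of $f$ on the segment,
and keep the first-order term in $t$. -/
theorem isSubgradient_of_isProx (hf : IsGammaZero f) {c : ℝ} (hc : 0 < c)
    {v p : EuclideanSpace ℝ (Fin n)} (h : IsProx c f v p) : IsSubgradient f p (c⁻¹ • (v - p)) := by
  have hval : ∀ q ∈ effDom f, (c : EReal) * f q + ((1 / 2 * ‖q - v‖ ^ 2 : ℝ) : EReal) =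
      ((c * (f q).toReal + 1 / 2 * ‖q - v‖ ^ 2 : ℝ) : EReal) := fun q hq => by
    rw [EReal.coe_add, EReal.coe_mul c, hf.coe_toReal hq]
  have hp : p ∈ effDom f := by
    obtain ⟨q, hq⟩ := hf.exists_ne_top
    intro htop
    have := h q
    simp only [] at this
    rw [hval q hq, htop, EReal.coe_mul_top_of_pos hc, EReal.top_add_coe] at this
    exact EReal.coe_ne_top _ (top_le_iff.1 this)
  refine ⟨hp, fun q hq => ?_⟩
  have hconv := hf.convexOn_toReal
  suffices 0 ≤ c * ((f q).toReal - (f p).toReal) - inner ℝ (v - p) (q - p) by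
    rw [inner_smul_left]
    simp only [conj_trivial]
    have h1 : c⁻¹ * (c * ((f q).toReal - (f p).toReal) - inner ℝ (v - p) (q - p)) =
        (f q).toReal - (f p).toReal - c⁻¹ * inner ℝ (v - p) (q - p) := by
      field_simp
    have h2 := mul_nonneg (inv_nonneg.2 hc.le) this
    linarith
  refine nonneg_of_forall_linear_add_sq (B := 1 / 2 * ‖q - p‖ ^ 2) fun t ht0 ht1 => ?_
  have hpt : (1 - t) • p + t • q = p + t • (q - p) := by
    rw [sub_smul, one_smul, smul_sub]; abel
  have hmem := hconv.1 hp hq (sub_nonneg.2 ht1.le) ht0.le (sub_add_cancel 1 t)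
  have hle := hconv.2 hp hq (sub_nonneg.2 ht1.le) ht0.le (sub_add_cancel 1 t)
  rw [hpt] at hmem hle
  have hmin := h (p + t • (q - p))
  simp only [] at hmin
  rw [hval _ hp, hval _ hmem, EReal.coe_le_coe_iff] at hmin
  have hsq : ‖p + t • (q - p) - v‖ ^ 2 =
      ‖p - v‖ ^ 2 - 2 * t * inner ℝ (v - p) (q - p) + t ^ 2 * ‖q - p‖ ^ 2 := by
    rw [add_sub_right_comm, norm_add_sq_real, inner_smul_right, norm_smul,
      Real.norm_of_nonneg ht0.le, ← neg_sub v p, inner_neg_left]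
    ring
  rw [hsq] at hmin
  simp only [smul_eq_mul] at hle
  nlinarith [mul_le_mul_of_nonneg_left hle hc.le]

/-- The subdifferential has closed graph: lower semicontinuity handles $f(p_k)$ and the pairing is
continuous. The limit lies in the domain because the inequality at one point $q$ with finite value
bounds $f(p_0)$. -/
theorem isSubgradient_of_tendsto (hf : IsGammaZero f) {ι : Type*} {l : Filter ι} [l.NeBot]
    {p u : ι → EuclideanSpace ℝ (Fin n)} {p₀ u₀ : EuclideanSpace ℝ (Fin n)}
    (h : ∀ k, IsSubgradient f (p k) (u k)) (hp : Tendsto p l (𝓝 p₀)) (hu : Tendsto u l (𝓝 u₀)) :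
    IsSubgradient f p₀ u₀ := by
  have key : ∀ q ∈ effDom f, f p₀ ≤ (((f q).toReal - inner ℝ u₀ (q - p₀) : ℝ) : EReal) := by
    intro q hq
    by_contra! hlt
    obtain ⟨r, hr1, hr2⟩ := EReal.lt_iff_exists_real_btwn.1 hlt
    have hev := hp.eventually (hf.lsc p₀ r hr2)
    have hlim : Tendsto (fun k => (f q).toReal - inner ℝ (u k) (q - p k)) l
        (𝓝 ((f q).toReal - inner ℝ u₀ (q - p₀))) :=
      (hu.inner (hp.const_sub q)).const_sub _
    have hle : r ≤ (f q).toReal - inner ℝ u₀ (q - p₀) := by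
      refine ge_of_tendsto hlim ?_
      filter_upwards [hev] with k hk
      rw [← hf.coe_toReal (h k).1, gt_iff_lt, EReal.coe_lt_coe_iff] at hk
      have := (h k).2 q hq
      linarith
    exact absurd (EReal.coe_lt_coe_iff.1 hr1) hle.not_gt
  have hp₀ : p₀ ∈ effDom f := by
    obtain ⟨q, hq⟩ := hf.exists_ne_top
    exact ((key q hq).trans_lt (EReal.coe_lt_top _)).ne
  refine ⟨hp₀, fun q hq => ?_⟩
  have := key q hq
  rw [← hf.coe_toReal hp₀, EReal.coe_le_coe_iff] at this
  linarith

end IsGammaZero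

/-! ### Optimality conditions for the composite objective -/

section Objective

variable {M : ℕ} {f : Fin M → EuclideanSpace ℝ (Fin n) → EReal}
  {g : Fin M → EuclideanSpace ℝ (Fin n) → ℝ} {L : Fin M → NNReal}

theorem objective_eq_coe (hf : ∀ i, IsGammaZero (f i)) {x : EuclideanSpace ℝ (Fin n)}
    (hx : ∀ i, x ∈ effDom (f i)) :
    objective f g x = ((∑ i, (f i x).toReal + ∑ i, g i x : ℝ) : EReal) := by
  rw [objective, ← Finset.sum_add_distrib]
  induction (Finset.univ : Finset (Fin M)) using Finset.cons_induction with
  | empty => simp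
  | cons i s hi ih =>
    rw [Finset.sum_cons, Finset.sum_cons, ih, EReal.coe_add, EReal.coe_add,
      (hf i).coe_toReal (hx i)]

theorem objective_eq_top (hf : ∀ i, IsGammaZero (f i)) {x : EuclideanSpace ℝ (Fin n)} {j : Fin M}
    (hx : x ∉ effDom (f j)) : objective f g x = ⊤ := by
  have hj : f j x = ⊤ := not_not.1 hx
  have hbot : ∀ s : Finset (Fin M), ∑ i ∈ s, (f i x + (g i x : EReal)) ≠ ⊥ := by
    intro s
    induction s using Finset.cons_induction with
    | empty => simp
    | cons i s hi ih =>
      rw [Finset.sum_cons]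
      exact EReal.add_ne_bot_iff.2 ⟨EReal.add_ne_bot_iff.2 ⟨(hf i).ne_bot x, EReal.coe_ne_bot _⟩, ih⟩
  rw [objective, ← Finset.add_sum_erase _ _ (Finset.mem_univ j), hj, EReal.top_add_coe]
  exact EReal.top_add_of_ne_bot (hbot _)

namespace IsProblem

theorem hasGradientAt (h : IsProblem f g L) (i : Fin M) (x : EuclideanSpace ℝ (Fin n)) :
    HasGradientAt (g i) (gradient (g i) x) x :=
  (h.differentiable i x).hasGradientAt

theorem norm_gradient_sub_le (h : IsProblem f g L) (i : Fin M) (x y : EuclideanSpace ℝ (Fin n)) :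
    ‖gradient (g i) x - gradient (g i) y‖ ≤ L i * ‖x - y‖ :=
  (h.lipschitz i).norm_sub_le x y

theorem neg_sq_le_inner (h : IsProblem f g L) (i : Fin M) (y x q : EuclideanSpace ℝ (Fin n)) :
    -((L i : ℝ) / 4 * ‖x - y‖ ^ 2) ≤
      inner ℝ (gradient (g i) y - gradient (g i) q) (x - q) :=
  (h.convex i).neg_sq_le_inner_gradient_sub (h.hasGradientAt i) (L i).2 (h.norm_gradient_sub_le i)
    y x q

theorem mem_argminSet_of_isSubgradient (h : IsProblem f g L) {x : EuclideanSpace ℝ (Fin n)}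
    {u : Fin M → EuclideanSpace ℝ (Fin n)} (hu : ∀ i, IsSubgradient (f i) x (u i))
    (hsum : ∑ i, u i = -∑ i, gradient (g i) x) : x ∈ argminSet (objective f g) := by
  intro q
  by_cases hq : ∀ i, q ∈ effDom (f i)
  · rw [objective_eq_coe h.gammaZero hq, objective_eq_coe h.gammaZero fun i => (hu i).1,
      EReal.coe_le_coe_iff]
    have h1 := Finset.sum_le_sum fun i (_ : i ∈ Finset.univ) => (hu i).2 q (hq i)
    have h2 := Finset.sum_le_sum fun i (_ : i ∈ Finset.univ) =>
      (h.convex i).add_inner_gradient_le (h.hasGradientAt i) (h.norm_gradient_sub_le i) x q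
    rw [Finset.sum_add_distrib, ← sum_inner] at h1 h2
    rw [hsum, inner_neg_left] at h1
    linarith
  · push Not at hq
    obtain ⟨j, hj⟩ := hq
    rw [objective_eq_top h.gammaZero hj]
    exact le_top

theorem exists_isSubgradient_of_mem_argminSet (h : IsProblem f g L)
    {x : EuclideanSpace ℝ (Fin n)} (hx : x ∈ argminSet (objective f g)) :
    ∃ u : Fin M → EuclideanSpace ℝ (Fin n), (∀ i, IsSubgradient (f i) x (u i)) ∧
      ∑ i, u i = -∑ i, gradient (g i) x := by
  obtain ⟨a, ha⟩ := h.ri_inter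
  rw [Set.mem_iInter] at ha
  have hxd : ∀ i, x ∈ effDom (f i) := by
    by_contra! hne
    obtain ⟨j, hj⟩ := hne
    have := hx a
    rw [objective_eq_top h.gammaZero hj,
      objective_eq_coe h.gammaZero fun i => intrinsicInterior_subset (ha i)] at this
    exact EReal.coe_ne_top _ (top_le_iff.1 this)
  obtain ⟨u, hu, hsum⟩ := exists_subgradients_sum_eq (fun i => (h.gammaZero i).convexOn_toReal)
    ha hxd (∑ i, gradient (g i) x) (fun q hq => by
      suffices 0 ≤ ∑ i, (f i q).toReal - ∑ i, (f i x).toReal +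
          inner ℝ (∑ i, gradient (g i) x) (q - x) by linarith
      -- A minimizer of $\Phi$ also minimizes the problem with each $g_i$ replaced by its
      -- linearization at $x$: on a segment the error is quadratic in $t$, with this constant from
      -- the quadratic upper bound.
      refine nonneg_of_forall_linear_add_sq (B := ∑ i, (L i : ℝ) / 2 * ‖q - x‖ ^ 2)
        fun t ht0 ht1 => ?_
      have hpt : (1 - t) • x + t • q = x + t • (q - x) := by
        rw [sub_smul, one_smul, smul_sub]; abel
      have hmem := fun i => (h.gammaZero i).convexOn_toReal.1 (hxd i) (hq i)
        (sub_nonneg.2 ht1.le) ht0.le (sub_add_cancel 1 t)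
      have hle := Finset.sum_le_sum fun i (_ : i ∈ Finset.univ) =>
        (h.gammaZero i).convexOn_toReal.2 (hxd i) (hq i)
          (sub_nonneg.2 ht1.le) ht0.le (sub_add_cancel 1 t)
      have hsm := Finset.sum_le_sum fun i (_ : i ∈ Finset.univ) =>
        le_add_inner_add_sq_of_lipschitz_gradient (h.hasGradientAt i) (h.norm_gradient_sub_le i)
          x (x + t • (q - x))
      rw [hpt] at hmem
      simp only [hpt, smul_eq_mul] at hle
      have hmin := hx (x + t • (q - x))
      rw [objective_eq_coe h.gammaZero hmem, objective_eq_coe h.gammaZero hxd,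
        EReal.coe_le_coe_iff] at hmin
      simp only [add_sub_cancel_left, norm_smul, Real.norm_of_nonneg ht0.le, mul_pow,
        inner_smul_right, Finset.sum_add_distrib, ← Finset.mul_sum, ← sum_inner] at hsm hle
      have hB : ∑ i, (L i : ℝ) / 2 * (t ^ 2 * ‖q - x‖ ^ 2) =
          t ^ 2 * ∑ i, (L i : ℝ) / 2 * ‖q - x‖ ^ 2 := by
        rw [Finset.mul_sum]
        exact Finset.sum_congr rfl fun i _ => by ring
      rw [hB] at hsm
      linarith)
  exact ⟨u, fun i => ⟨hxd i, hu i⟩, hsum⟩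

end IsProblem

end Objective

end ExtendedReal

/-! ### Consequences of the parameter ranges -/

namespace IsAdmissible

variable {N : ℕ} {L : Fin (N + 1) → NNReal} {σ γ : ℝ} {α lam : Fin N → ℝ}

/-- The first step-size bound cleared of its denominator; when the denominator is $0$ the bound is
void and $\alpha_i\ge0$ suffices. -/
theorem lipschitz_mul_le (h : IsAdmissible L σ γ α lam) (i : Fin N) :
    γ * ((L (Fin.last N) : ℝ) / N + σ * L i.castSucc) ≤ 2 * α i := by
  have hσ := h.sigma_mem.1
  rcases eq_or_ne ((L (Fin.last N) : ℝ) / N + σ * L i.castSucc) 0 with h0 | h0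
  · rw [h0, mul_zero]
    linarith [h.alpha_nonneg i]
  · have hpos : 0 < (L (Fin.last N) : ℝ) / N + σ * L i.castSucc :=
      lt_of_le_of_ne (by positivity) h0.symm
    exact ((lt_div_iff₀ hpos).1 (h.gamma_lt_one i h0)).le

/-- The decrease coefficient of `‖yᵢ - x‖²` in the Lyapunov inequality. -/
theorem server_coeff_pos_or (h : IsAdmissible L σ γ α lam) (i : Fin N) :
    0 < α i / 2 - γ * ((L (Fin.last N) : ℝ) / N + σ * L i.castSucc) / 4 ∨ α i = 0 := by
  have hσ := h.sigma_mem.1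
  rcases eq_or_ne ((L (Fin.last N) : ℝ) / N + σ * L i.castSucc) 0 with h0 | h0
  · rcases (h.alpha_nonneg i).eq_or_lt with h1 | h1
    · exact Or.inr h1.symm
    · left
      rw [h0]
      linarith
  · left
    have hpos : 0 < (L (Fin.last N) : ℝ) / N + σ * L i.castSucc :=
      lt_of_le_of_ne (by positivity) h0.symm
    have := (lt_div_iff₀ hpos).1 (h.gamma_lt_one i h0)
    linarith

theorem server_coeff_nonneg (h : IsAdmissible L σ γ α lam) (i : Fin N) :
    0 ≤ α i / 2 - γ * ((L (Fin.last N) : ℝ) / N + σ * L i.castSucc) / 4 := by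
  linarith [h.lipschitz_mul_le i]

theorem user_coeff_pos (h : IsAdmissible L σ γ α lam) (i : Fin N) :
    0 < 1 + α i / 2 - lam i / 2 - (1 - σ) * γ * L i.castSucc / 4 := by
  linarith [(h.lam_mem i).2]

end IsAdmissible

/-! ### The steps as inclusions, stationary pairs and the Lyapunov decrease -/

section Steps

variable {n N : ℕ}

/-- The unnormalized residual of the server's inclusion. -/
noncomputable def serverResidual (g : Fin (N + 1) → EuclideanSpace ℝ (Fin n) → ℝ) (σ γ : ℝ)
    (α : Fin N → ℝ) (y z : Fin N → EuclideanSpace ℝ (Fin n)) (x : EuclideanSpace ℝ (Fin n)) :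
    EuclideanSpace ℝ (Fin n) :=
  ∑ i, (z i - x + α i • (y i - x) - (γ / N) • gradient (g (Fin.last N)) (y i)
    - (σ * γ) • gradient (g i.castSucc) (y i))

/-- The server's step, as an inclusion. -/
def IsServerStep (f : Fin (N + 1) → EuclideanSpace ℝ (Fin n) → EReal)
    (g : Fin (N + 1) → EuclideanSpace ℝ (Fin n) → ℝ) (σ γ : ℝ) (α : Fin N → ℝ)
    (y z : Fin N → EuclideanSpace ℝ (Fin n)) (x : EuclideanSpace ℝ (Fin n)) : Prop :=
  IsSubgradient (f (Fin.last N)) x (γ⁻¹ • serverResidual g σ γ α y z x)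

/-- A user's step, as an inclusion. -/
def IsUserStep (f : EuclideanSpace ℝ (Fin n) → EReal) (g : EuclideanSpace ℝ (Fin n) → ℝ)
    (σ γ a : ℝ) (x z w : EuclideanSpace ℝ (Fin n)) : Prop :=
  IsSubgradient f w (γ⁻¹ • (userArg g σ γ a x z w - w))

/-- A stationary pair `(x, z)` of the splitting method. -/
def IsFixedPair (f : Fin (N + 1) → EuclideanSpace ℝ (Fin n) → EReal)
    (g : Fin (N + 1) → EuclideanSpace ℝ (Fin n) → ℝ) (σ γ : ℝ) (α : Fin N → ℝ)
    (x : EuclideanSpace ℝ (Fin n)) (z : Fin N → EuclideanSpace ℝ (Fin n)) : Prop :=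
  IsServerStep f g σ γ α (fun _ => x) z x ∧
    ∀ i, IsUserStep (f i.castSucc) (g i.castSucc) σ γ (α i) x (z i) x

/-- The Lyapunov function of a single user. -/
noncomputable def userLyapunov (lam a : ℝ) (xs zs y z : EuclideanSpace ℝ (Fin n)) : ℝ :=
  ‖z - zs‖ ^ 2 / (2 * lam) + a / 2 * ‖y - xs‖ ^ 2

theorem IsGammaZero.isUserStep_of_isProx {f : EuclideanSpace ℝ (Fin n) → EReal}
    (hf : IsGammaZero f) {g : EuclideanSpace ℝ (Fin n) → ℝ} {σ γ a : ℝ} (hγ : 0 < γ)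
    {x z w : EuclideanSpace ℝ (Fin n)} (h : IsProx γ f (userArg g σ γ a x z w) w) :
    IsUserStep f g σ γ a x z w :=
  hf.isSubgradient_of_isProx hγ h

variable {f : Fin (N + 1) → EuclideanSpace ℝ (Fin n) → EReal}
  {g : Fin (N + 1) → EuclideanSpace ℝ (Fin n) → ℝ} {L : Fin (N + 1) → NNReal}
  {σ γ : ℝ} {α lam : Fin N → ℝ}

theorem IsGammaZero.isServerStep_of_isProx (hN : 1 ≤ N) (hf : IsGammaZero (f (Fin.last N)))
    (hγ : 0 < γ) {y z : Fin N → EuclideanSpace ℝ (Fin n)} {x : EuclideanSpace ℝ (Fin n)}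
    (h : IsProx (γ / N) (f (Fin.last N)) (serverArg g σ γ α y z x) x) :
    IsServerStep f g σ γ α y z x := by
  have hN0 : (0 : ℝ) < N := by exact_mod_cast hN
  have := hf.isSubgradient_of_isProx (by positivity) h
  rw [IsServerStep]
  convert this using 1
  have h1 : (γ / N)⁻¹ = γ⁻¹ * N := by rw [inv_div, div_eq_inv_mul]
  rw [h1, mul_smul]
  congr 1
  have h2 : (N : ℝ) • x = ∑ _i : Fin N, x := by
    rw [Finset.sum_const, Finset.card_univ, Fintype.card_fin, Nat.cast_smul_eq_nsmul]
  rw [smul_sub, h2, serverArg, smul_sub, smul_smul, smul_smul, mul_one_div_cancel hN0.ne', one_smul,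
    mul_div_cancel₀ _ hN0.ne', Finset.smul_sum, ← Finset.sum_sub_distrib, ← Finset.sum_sub_distrib,
    serverResidual]
  exact Finset.sum_congr rfl fun i _ => by abel

/-- The two subgradients differ by $-\gamma^{-1}(1+a)(w-w')$, which monotonicity permits only for
$w=w'$. This identifies an actual update with the virtual one. -/
theorem IsUserStep.eq {f : EuclideanSpace ℝ (Fin n) → EReal} {g : EuclideanSpace ℝ (Fin n) → ℝ}
    {a : ℝ} (hγ : 0 < γ) (ha : 0 ≤ a) {x z w w' : EuclideanSpace ℝ (Fin n)}
    (h : IsUserStep f g σ γ a x z w) (h' : IsUserStep f g σ γ a x z w') : w = w' := by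
  have h1 := IsSubgradient.inner_nonneg h h'
  have h2 : γ⁻¹ • (userArg g σ γ a x z w - w) - γ⁻¹ • (userArg g σ γ a x z w' - w') =
      -((γ⁻¹ * (1 + a)) • (w - w')) := by
    simp only [userArg]
    module
  rw [h2, inner_neg_left, inner_smul_left, real_inner_self_eq_norm_sq] at h1
  simp only [conj_trivial] at h1
  have h3 : 0 < γ⁻¹ * (1 + a) := by positivity
  have h4 : ‖w - w'‖ ^ 2 ≤ 0 := by
    by_contra! hlt
    nlinarith [mul_pos h3 hlt]
  exact sub_eq_zero.1 (norm_eq_zero.1 (pow_eq_zero_iff two_ne_zero |>.1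
    (le_antisymm h4 (sq_nonneg _))))

/-- The gradient terms in the server step are controlled by the damping parameter. -/
theorem IsProblem.norm_server_gradients_le (h : IsProblem f g L) (hpar : IsAdmissible L σ γ α lam)
    (i : Fin N) (y y' : EuclideanSpace ℝ (Fin n)) :
    ‖(γ / N) • (gradient (g (Fin.last N)) y - gradient (g (Fin.last N)) y') +
      (σ * γ) • (gradient (g i.castSucc) y - gradient (g i.castSucc) y')‖ ≤
      2 * α i * ‖y - y'‖ := by
  have hγ := hpar.gamma_pos
  have hσ := hpar.sigma_mem.1
  refine (norm_add_le _ _).trans ?_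
  rw [norm_smul, norm_smul, Real.norm_of_nonneg (by positivity : 0 ≤ γ / N),
    Real.norm_of_nonneg (by positivity : 0 ≤ σ * γ)]
  have h1 := mul_le_mul_of_nonneg_left (h.norm_gradient_sub_le (Fin.last N) y y')
    (by positivity : 0 ≤ γ / N)
  have h2 := mul_le_mul_of_nonneg_left (h.norm_gradient_sub_le i.castSucc y y')
    (by positivity : 0 ≤ σ * γ)
  have h3 := mul_le_mul_of_nonneg_right (hpar.lipschitz_mul_le i) (norm_nonneg (y - y'))
  have h4 : γ * ((L (Fin.last N) : ℝ) / N + σ * L i.castSucc) * ‖y - y'‖ =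
      γ / N * (L (Fin.last N) * ‖y - y'‖) + σ * γ * (L i.castSucc * ‖y - y'‖) := by ring
  linarith

/-- Each summand of the residual contains $-(1+\alpha_i)x$, so monotonicity bounds $x-x'$ by the
data. The factor $3\alpha_i$ is $\alpha_i$ from damping plus $2\alpha_i$ from the gradients. Both
uniqueness of the server step and boundedness of the iterates rest on this. -/
theorem IsServerStep.mul_norm_sub_le (hfg : IsProblem f g L) (hpar : IsAdmissible L σ γ α lam)
    {y z y' z' : Fin N → EuclideanSpace ℝ (Fin n)} {x x' : EuclideanSpace ℝ (Fin n)}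
    (h : IsServerStep f g σ γ α y z x) (h' : IsServerStep f g σ γ α y' z' x') :
    N * ‖x - x'‖ ≤ ∑ i, (‖z i - z' i‖ + 3 * α i * ‖y i - y' i‖) := by
  have hγ := hpar.gamma_pos
  have h1 := IsSubgradient.inner_nonneg h h'
  rw [← smul_sub, inner_smul_left] at h1
  have h2 : 0 ≤ inner ℝ (serverResidual g σ γ α y z x - serverResidual g σ γ α y' z' x')
      (x - x') := by
    simp only [conj_trivial] at h1
    exact nonneg_of_mul_nonneg_right h1 (inv_pos.2 hγ)
  have h3 : inner ℝ (serverResidual g σ γ α y z x - serverResidual g σ γ α y' z' x') (x - x') ≤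
      ∑ i, ((‖z i - z' i‖ + 3 * α i * ‖y i - y' i‖) * ‖x - x'‖ - ‖x - x'‖ ^ 2) := by
    rw [serverResidual, serverResidual, ← Finset.sum_sub_distrib, sum_inner]
    refine Finset.sum_le_sum fun i _ => ?_
    have e : z i - x + α i • (y i - x) - (γ / N) • gradient (g (Fin.last N)) (y i)
        - (σ * γ) • gradient (g i.castSucc) (y i) -
        (z' i - x' + α i • (y' i - x') - (γ / N) • gradient (g (Fin.last N)) (y' i)
          - (σ * γ) • gradient (g i.castSucc) (y' i)) =
        ((z i - z' i) + α i • (y i - y' i) -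
          ((γ / N) • (gradient (g (Fin.last N)) (y i) - gradient (g (Fin.last N)) (y' i)) +
          (σ * γ) • (gradient (g i.castSucc) (y i) - gradient (g i.castSucc) (y' i))))
        - (1 + α i) • (x - x') := by module
    rw [e, inner_sub_left, inner_smul_left, real_inner_self_eq_norm_sq]
    simp only [conj_trivial]
    have hα := hpar.alpha_nonneg i
    have b1 := real_inner_le_norm ((z i - z' i) + α i • (y i - y' i) -
          ((γ / N) • (gradient (g (Fin.last N)) (y i) - gradient (g (Fin.last N)) (y' i)) +
          (σ * γ) • (gradient (g i.castSucc) (y i) - gradient (g i.castSucc) (y' i)))) (x - x')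
    have b2 := hfg.norm_server_gradients_le hpar i (y i) (y' i)
    have b3 : ‖(z i - z' i) + α i • (y i - y' i) -
          ((γ / N) • (gradient (g (Fin.last N)) (y i) - gradient (g (Fin.last N)) (y' i)) +
          (σ * γ) • (gradient (g i.castSucc) (y i) - gradient (g i.castSucc) (y' i)))‖ ≤
        ‖z i - z' i‖ + 3 * α i * ‖y i - y' i‖ := by
      refine (norm_sub_le _ _).trans ?_
      have := norm_add_le (z i - z' i) (α i • (y i - y' i))
      rw [norm_smul, Real.norm_of_nonneg hα] at this
      linarith
    have b4 := mul_le_mul_of_nonneg_right b3 (norm_nonneg (x - x'))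
    have b5 : 0 ≤ α i * ‖x - x'‖ ^ 2 := by positivity
    linarith
  rw [Finset.sum_sub_distrib, ← Finset.sum_mul, Finset.sum_const, Finset.card_univ, Fintype.card_fin,
    nsmul_eq_mul] at h3
  rcases (norm_nonneg (x - x')).eq_or_lt with h0 | h0
  · rw [← h0, mul_zero]
    exact Finset.sum_nonneg fun i _ => add_nonneg (norm_nonneg _)
      (mul_nonneg (mul_nonneg (by norm_num) (hpar.alpha_nonneg i)) (norm_nonneg _))
  · refine le_of_mul_le_mul_right ?_ h0
    nlinarith

theorem IsServerStep.eq (hN : 1 ≤ N) (hfg : IsProblem f g L) (hpar : IsAdmissible L σ γ α lam)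
    {y z : Fin N → EuclideanSpace ℝ (Fin n)} {x x' : EuclideanSpace ℝ (Fin n)}
    (h : IsServerStep f g σ γ α y z x) (h' : IsServerStep f g σ γ α y z x') : x = x' := by
  have h1 := h.mul_norm_sub_le hfg hpar h'
  have hN0 : (0 : ℝ) < N := by exact_mod_cast hN
  simp only [sub_self, norm_zero, mul_zero, add_zero, Finset.sum_const_zero] at h1
  have h2 : ‖x - x'‖ ≤ 0 := by
    by_contra! hlt
    linarith [mul_pos hN0 hlt]
  exact sub_eq_zero.1 (norm_eq_zero.1 (le_antisymm h2 (norm_nonneg _)))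

theorem IsProblem.exists_isFixedPair (hN : 1 ≤ N) (hfg : IsProblem f g L) (hγ : 0 < γ) :
    ∃ x z, IsFixedPair f g σ γ α x z := by
  have hN0 : (0 : ℝ) < N := by exact_mod_cast hN
  obtain ⟨x, hx⟩ := hfg.exists_min
  obtain ⟨u, hu, hsum⟩ := hfg.exists_isSubgradient_of_mem_argminSet hx
  rw [Fin.sum_univ_castSucc, Fin.sum_univ_castSucc] at hsum
  -- This $z_i$ is obtained by solving user $i$'s stationary inclusion with subgradient $u_i$; the
  -- server's inclusion is then the sum condition on the $u_i$.
  refine ⟨x, fun i => x - ((1 - σ) * γ) • gradient (g i.castSucc) x - γ • u i.castSucc, ?_, ?_⟩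
  · have : serverResidual g σ γ α (fun _ => x) (fun i => x - ((1 - σ) * γ) •
        gradient (g i.castSucc) x - γ • u i.castSucc) x = γ • u (Fin.last N) := by
      have e : ∀ i : Fin N, x - ((1 - σ) * γ) • gradient (g i.castSucc) x - γ • u i.castSucc - x +
          α i • (x - x) - (γ / N) • gradient (g (Fin.last N)) x
          - (σ * γ) • gradient (g i.castSucc) x = -(γ • (u i.castSucc + gradient (g i.castSucc) x))
          - (γ / N) • gradient (g (Fin.last N)) x := fun i => by module
      simp only [serverResidual, e]
      rw [Finset.sum_sub_distrib, Finset.sum_neg_distrib, ← Finset.smul_sum, Finset.sum_add_distrib,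
        Finset.sum_const, Finset.card_univ, Fintype.card_fin, ← Nat.cast_smul_eq_nsmul ℝ, smul_smul,
        mul_div_cancel₀ _ hN0.ne', ← smul_neg, ← smul_sub]
      congr 1
      rw [← sub_eq_zero] at hsum ⊢
      rw [← neg_eq_zero, ← hsum]
      abel
    rw [IsServerStep, this, smul_smul, inv_mul_cancel₀ hγ.ne', one_smul]
    exact hu _
  · intro i
    have : userArg (g i.castSucc) σ γ (α i) x
        (x - ((1 - σ) * γ) • gradient (g i.castSucc) x - γ • u i.castSucc) x - x =
        γ • u i.castSucc := by
      rw [userArg]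
      module
    rw [IsUserStep, this, smul_smul, inv_mul_cancel₀ hγ.ne', one_smul]
    exact hu _

theorem IsFixedPair.mem_argminSet (hN : 1 ≤ N) (hfg : IsProblem f g L) (hγ : 0 < γ)
    {x : EuclideanSpace ℝ (Fin n)} {z : Fin N → EuclideanSpace ℝ (Fin n)}
    (h : IsFixedPair f g σ γ α x z) : x ∈ argminSet (objective f g) := by
  have hN0 : (0 : ℝ) < N := by exact_mod_cast hN
  refine hfg.mem_argminSet_of_isSubgradient
    (u := Fin.lastCases (motive := fun _ => EuclideanSpace ℝ (Fin n))
      (γ⁻¹ • serverResidual g σ γ α (fun _ => x) z x)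
      fun i => γ⁻¹ • (userArg (g i.castSucc) σ γ (α i) x (z i) x - x)) ?_ ?_
  · intro i
    induction i using Fin.lastCases with
    | last => simpa [IsServerStep] using h.1
    | cast i => simpa [IsUserStep] using h.2 i
  · rw [Fin.sum_univ_castSucc, Fin.sum_univ_castSucc]
    simp only [Fin.lastCases_castSucc, Fin.lastCases_last]
    rw [← Finset.smul_sum, ← smul_add, serverResidual, ← Finset.sum_add_distrib]
    have e : ∀ i : Fin N, userArg (g i.castSucc) σ γ (α i) x (z i) x - x +
        (z i - x + α i • (x - x) - (γ / N) • gradient (g (Fin.last N)) x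
          - (σ * γ) • gradient (g i.castSucc) x) =
        -(γ • gradient (g i.castSucc) x) - (γ / N) • gradient (g (Fin.last N)) x := fun i => by
      rw [userArg]
      module
    simp only [e]
    rw [Finset.sum_sub_distrib, Finset.sum_neg_distrib, ← Finset.smul_sum,
      Finset.sum_const, Finset.card_univ, Fintype.card_fin, ← Nat.cast_smul_eq_nsmul ℝ, smul_smul,
      mul_div_cancel₀ _ hN0.ne', ← smul_neg, ← smul_sub, smul_smul, inv_mul_cancel₀ hγ.ne', one_smul]
    abel

/-- The algebraic identity behind the Lyapunov inequality, for a single user. -/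
theorem inner_server_add_inner_user_le {E : Type*} [NormedAddCommGroup E] [InnerProductSpace ℝ E]
    {ζ a b e Gm Gs Gu : E} {α' l s t r Lm Ls Lu : ℝ} (hl : 0 < l) (hs : 0 ≤ s) (ht : 0 ≤ t)
    (hr : 0 ≤ r) (hm : -(Lm / 4 * ‖e - a‖ ^ 2) ≤ inner ℝ Gm a)
    (hu : -(Ls / 4 * ‖e - a‖ ^ 2) ≤ inner ℝ Gs a)
    (hv : -(Lu / 4 * ‖a - b‖ ^ 2) ≤ inner ℝ Gu b) :
    inner ℝ (ζ - a + α' • (e - a) - s • Gm - t • Gs) a +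
      inner ℝ ((2 : ℝ) • a - ζ + α' • (a - b) - r • Gu - b) b ≤
    (‖ζ‖ ^ 2 / (2 * l) + α' / 2 * ‖e‖ ^ 2) - (‖ζ + l • (b - a)‖ ^ 2 / (2 * l) + α' / 2 * ‖b‖ ^ 2)
      - ((α' / 2 - (s * Lm + t * Ls) / 4) * ‖e - a‖ ^ 2
        + (1 + α' / 2 - l / 2 - r * Lu / 4) * ‖a - b‖ ^ 2) := by
  have hm' := mul_le_mul_of_nonneg_left hm hs
  have hu' := mul_le_mul_of_nonneg_left hu ht
  have hv' := mul_le_mul_of_nonneg_left hv hr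
  -- The pairings $\langle\zeta,a\rangle$ and $-\langle\zeta,b\rangle$ from server and user form
  -- exactly this cross term, while $\alpha'\langle e-a,a\rangle+\alpha'\langle a-b,b\rangle$
  -- telescopes by polarization.
  have h1 : ‖ζ + l • (b - a)‖ ^ 2 / (2 * l) =
      ‖ζ‖ ^ 2 / (2 * l) + inner ℝ ζ (b - a) + l / 2 * ‖a - b‖ ^ 2 := by
    rw [norm_add_sq_real, inner_smul_right, norm_smul, Real.norm_of_nonneg hl.le, norm_sub_rev b a]
    field_simp
  have h2 : ‖e - a‖ ^ 2 = ‖e‖ ^ 2 - 2 * inner ℝ e a + ‖a‖ ^ 2 := norm_sub_sq_real e a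
  have h3 : ‖a - b‖ ^ 2 = ‖a‖ ^ 2 - 2 * inner ℝ a b + ‖b‖ ^ 2 := norm_sub_sq_real a b
  rw [h1]
  simp only [inner_sub_left, inner_add_left, inner_smul_left, inner_sub_right, conj_trivial,
    real_inner_self_eq_norm_sq]
  rw [h2] at hm' hu' ⊢
  rw [h3] at hv' ⊢
  linarith

/-- One full virtual sweep decreases the total Lyapunov function. -/
theorem IsFixedPair.sum_userLyapunov_le (hfg : IsProblem f g L) (hpar : IsAdmissible L σ γ α lam)
    {xs x : EuclideanSpace ℝ (Fin n)} {zs y z w : Fin N → EuclideanSpace ℝ (Fin n)}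
    (hs : IsFixedPair f g σ γ α xs zs) (hx : IsServerStep f g σ γ α y z x)
    (hw : ∀ i, IsUserStep (f i.castSucc) (g i.castSucc) σ γ (α i) x (z i) (w i)) :
    ∑ i, userLyapunov (lam i) (α i) xs (zs i) (w i) (z i + lam i • (w i - x)) ≤
      ∑ i, userLyapunov (lam i) (α i) xs (zs i) (y i) (z i) -
      ∑ i, ((α i / 2 - γ * ((L (Fin.last N) : ℝ) / N + σ * L i.castSucc) / 4) * ‖x - y i‖ ^ 2
        + (1 + α i / 2 - lam i / 2 - (1 - σ) * γ * L i.castSucc / 4) * ‖x - w i‖ ^ 2) := by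
  have hγ := hpar.gamma_pos
  have hσ := hpar.sigma_mem
  have hT : 0 ≤ inner ℝ (serverResidual g σ γ α y z x - serverResidual g σ γ α (fun _ => xs) zs xs)
      (x - xs) := by
    have h1 := IsSubgradient.inner_nonneg hx hs.1
    rw [← smul_sub, inner_smul_left] at h1
    exact nonneg_of_mul_nonneg_right (by simpa only [conj_trivial] using h1) (inv_pos.2 hγ)
  have hU : ∀ i, 0 ≤ inner ℝ ((userArg (g i.castSucc) σ γ (α i) x (z i) (w i) - w i) -
      (userArg (g i.castSucc) σ γ (α i) xs (zs i) xs - xs)) (w i - xs) := fun i => by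
    have h1 := IsSubgradient.inner_nonneg (hw i) (hs.2 i)
    rw [← smul_sub, inner_smul_left] at h1
    exact nonneg_of_mul_nonneg_right (by simpa only [conj_trivial] using h1) (inv_pos.2 hγ)
  rw [serverResidual, serverResidual, ← Finset.sum_sub_distrib, sum_inner] at hT
  -- The server inclusion is available only summed over users, so the user inequalities are summed
  -- too before comparing term by term.
  have hTU := add_nonneg hT (Finset.sum_nonneg fun i (_ : i ∈ Finset.univ) => hU i)
  rw [← Finset.sum_add_distrib] at hTU
  rw [← sub_nonneg, ← Finset.sum_sub_distrib, ← Finset.sum_sub_distrib]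
  refine hTU.trans (Finset.sum_le_sum fun i _ => ?_)
  have hsub : ∀ p q r : EuclideanSpace ℝ (Fin n), ‖(p - r) - (q - r)‖ = ‖q - p‖ := fun p q r => by
    rw [sub_sub_sub_cancel_right, norm_sub_rev]
  have key := inner_server_add_inner_user_le (ζ := z i - zs i) (a := x - xs) (b := w i - xs)
    (e := y i - xs) (Gm := gradient (g (Fin.last N)) (y i) - gradient (g (Fin.last N)) xs)
    (Gs := gradient (g i.castSucc) (y i) - gradient (g i.castSucc) xs)
    (Gu := gradient (g i.castSucc) x - gradient (g i.castSucc) xs)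
    (α' := α i) (s := γ / N) (t := σ * γ) (r := (1 - σ) * γ)
    (Lm := L (Fin.last N)) (Ls := L i.castSucc) (Lu := L i.castSucc)
    (hpar.lam_mem i).1 (by positivity) (mul_nonneg hσ.1 hγ.le)
    (mul_nonneg (sub_nonneg.2 hσ.2) hγ.le)
    (by rw [hsub]; exact hfg.neg_sq_le_inner _ _ _ _)
    (by rw [hsub]; exact hfg.neg_sq_le_inner _ _ _ _)
    (by rw [hsub]; exact hfg.neg_sq_le_inner _ _ _ _)
  have e1 : z i - x + α i • (y i - x) - (γ / N) • gradient (g (Fin.last N)) (y i)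
      - (σ * γ) • gradient (g i.castSucc) (y i) -
      (zs i - xs + α i • (xs - xs) - (γ / N) • gradient (g (Fin.last N)) xs
        - (σ * γ) • gradient (g i.castSucc) xs) =
      (z i - zs i) - (x - xs) + α i • ((y i - xs) - (x - xs)) - (γ / N) •
        (gradient (g (Fin.last N)) (y i) - gradient (g (Fin.last N)) xs) - (σ * γ) •
        (gradient (g i.castSucc) (y i) - gradient (g i.castSucc) xs) := by module
  have e2 : (userArg (g i.castSucc) σ γ (α i) x (z i) (w i) - w i) -
      (userArg (g i.castSucc) σ γ (α i) xs (zs i) xs - xs) =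
      (2 : ℝ) • (x - xs) - (z i - zs i) + α i • ((x - xs) - (w i - xs)) - ((1 - σ) * γ) •
        (gradient (g i.castSucc) x - gradient (g i.castSucc) xs) - (w i - xs) := by
    simp only [userArg]
    module
  rw [e1, e2]
  refine key.trans_eq ?_
  have e3 : z i + lam i • (w i - x) - zs i = z i - zs i + lam i • (w i - xs - (x - xs)) := by module
  rw [userLyapunov, userLyapunov, e3, hsub, sub_sub_sub_cancel_right x (w i) xs]
  ring

/-- Limits of asymptotically stationary states are stationary. -/
theorem isFixedPair_of_tendsto (hfg : IsProblem f g L) (hpar : IsAdmissible L σ γ α lam)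
    {ι : Type*} {l : Filter ι} [l.NeBot] {x : ι → EuclideanSpace ℝ (Fin n)}
    {y z w : ι → Fin N → EuclideanSpace ℝ (Fin n)} {x₀ : EuclideanSpace ℝ (Fin n)}
    {z₀ : Fin N → EuclideanSpace ℝ (Fin n)}
    (hserver : ∀ k, IsServerStep f g σ γ α (y k) (z k) (x k))
    (huser : ∀ k i, IsUserStep (f i.castSucc) (g i.castSucc) σ γ (α i) (x k) (z k i) (w k i))
    (hx : Tendsto x l (𝓝 x₀)) (hz : ∀ i, Tendsto (fun k => z k i) l (𝓝 (z₀ i)))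
    (hw : ∀ i, Tendsto (fun k => w k i) l (𝓝 x₀))
    (hy : ∀ i, Tendsto (fun k => α i * ‖x k - y k i‖) l (𝓝 0)) :
    IsFixedPair f g σ γ α x₀ z₀ := by
  have hgrad : ∀ i, Tendsto (fun k => gradient (g i) (x k)) l (𝓝 (gradient (g i) x₀)) := fun i =>
    ((hfg.lipschitz i).continuous.tendsto x₀).comp hx
  constructor
  · refine (hfg.gammaZero _).isSubgradient_of_tendsto hserver hx (Tendsto.const_smul ?_ _)
    unfold serverResidual
    refine tendsto_finsetSum _ fun i _ => ?_
    have hα := hpar.alpha_nonneg i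
    -- Replacing $y_i$ by $x$ in the residual costs at most $3\alpha_i\|x-y_i\|$. Hence no
    -- convergence of $y_i$ itself is needed when $\alpha_i=0$.
    have herr : Tendsto (fun k => α i • (y k i - x k) -
        ((γ / N) • (gradient (g (Fin.last N)) (y k i) - gradient (g (Fin.last N)) (x k)) +
        (σ * γ) • (gradient (g i.castSucc) (y k i) - gradient (g i.castSucc) (x k)))) l (𝓝 0) := by
      refine squeeze_zero_norm (a := fun k => 3 * (α i * ‖x k - y k i‖)) (fun k => ?_) ?_
      · refine (norm_sub_le _ _).trans ?_
        have := hfg.norm_server_gradients_le hpar i (y k i) (x k)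
        rw [norm_smul, Real.norm_of_nonneg hα]
        rw [norm_sub_rev (y k i)] at this ⊢
        linarith
      · simpa using (hy i).const_mul 3
    have hmain : Tendsto (fun k => z k i - x k - (γ / N) • gradient (g (Fin.last N)) (x k)
        - (σ * γ) • gradient (g i.castSucc) (x k)) l (𝓝 (z₀ i - x₀ - (γ / N) •
          gradient (g (Fin.last N)) x₀ - (σ * γ) • gradient (g i.castSucc) x₀)) :=
      (((hz i).sub hx).sub ((hgrad _).const_smul _)).sub ((hgrad _).const_smul _)
    have := hmain.add herr
    convert this using 2
    · module
    · module
  · intro i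
    refine (hfg.gammaZero _).isSubgradient_of_tendsto (huser · i) (hw i) (Tendsto.const_smul ?_ _)
    unfold userArg
    exact ((((hx.const_smul _).sub (hz i)).add ((hx.sub (hw i)).const_smul _)).sub
      ((hgrad _).const_smul _)).sub (hw i)

end Steps

/-! ### Finite-range random variables, supermartingales and independent trials -/

section Probability

theorem finite_range_of_factors_through {Ω T β : Type*} {s : Ω → T} {f : Ω → β}
    (hfin : (Set.range s).Finite) (hfac : ∀ ω ω', s ω = s ω' → f ω = f ω') :
    (Set.range f).Finite := by
  obtain ⟨h, hh⟩ : ∃ h : Set.range s → β, ∀ ω, f ω = h ⟨s ω, ω, rfl⟩ :=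
    ⟨fun t => f t.2.choose, fun ω => hfac _ _ (Exists.choose_spec (⟨ω, rfl⟩ : ∃ ω', s ω' = s ω)).symm⟩
  have := hfin.to_subtype
  refine (Set.finite_range h).subset ?_
  rintro _ ⟨ω, rfl⟩
  exact ⟨_, (hh ω).symm⟩

variable {Ω : Type*} [mΩ : MeasurableSpace Ω] {P : Measure Ω}

/-- Preimages are preimages under $s$ of finite sets, so no regularity of the factoring map is
required; proximal updates are thereby measurable for free. -/
theorem measurable_of_factors_through_finite_range {T β : Type*} [MeasurableSpace T]
    [MeasurableSingletonClass T] [MeasurableSpace β] {s : Ω → T} {f : Ω → β} (hs : Measurable s)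
    (hfin : (Set.range s).Finite) (hfac : ∀ ω ω', s ω = s ω' → f ω = f ω') : Measurable f := by
  intro B _
  have : f ⁻¹' B = s ⁻¹' (s '' (f ⁻¹' B)) := by
    refine subset_antisymm (Set.subset_preimage_image _ _) ?_
    rintro ω ⟨ω', hω', heq⟩
    rw [Set.mem_preimage, ← hfac _ _ heq]
    exact hω'
  rw [this]
  exact hs (hfin.subset (Set.image_subset_range _ _)).measurableSet

theorem integrable_of_finite_range [IsFiniteMeasure P] {f : Ω → ℝ} (hf : Measurable f)
    (hfin : (Set.range f).Finite) : Integrable f P := by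
  obtain ⟨C, hC⟩ := (hfin.image (fun x => ‖x‖)).bddAbove
  exact Integrable.of_bound hf.aestronglyMeasurable C
    (Eventually.of_forall fun ω => hC ⟨_, ⟨ω, rfl⟩, rfl⟩)

/-- The Robbins–Siegmund theorem without perturbation terms. -/
theorem ae_tendsto_of_setIntegral_succ_le [IsFiniteMeasure P] {ℱ : Filtration ℕ mΩ}
    {V R : ℕ → Ω → ℝ} (hV : StronglyAdapted ℱ V) (hR : StronglyAdapted ℱ R)
    (hVi : ∀ k, Integrable (V k) P) (hRi : ∀ k, Integrable (R k) P)
    (hV0 : ∀ k ω, 0 ≤ V k ω) (hR0 : ∀ k ω, 0 ≤ R k ω)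
    (h : ∀ k s, MeasurableSet[ℱ k] s →
      ∫ ω in s, V (k + 1) ω ∂P ≤ ∫ ω in s, V k ω ∂P - ∫ ω in s, R k ω ∂P) :
    ∀ᵐ ω ∂P, (∃ c, Tendsto (fun k => V k ω) atTop (𝓝 c)) ∧
      Tendsto (fun k => R k ω) atTop (𝓝 0) := by
  -- A nonnegative supermartingale, hence bounded in $L^1$ and almost surely convergent. Its limit
  -- bounds the sums of the $R_j$, which are therefore summable, and subtracting them leaves
  -- convergence of $V_k$.
  let M : ℕ → Ω → ℝ := fun k ω => V k ω + ∑ j ∈ Finset.range k, R j ω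
  have hM0 : ∀ k ω, 0 ≤ M k ω := fun k ω =>
    add_nonneg (hV0 k ω) (Finset.sum_nonneg fun j _ => hR0 j ω)
  have hMi : ∀ k, Integrable (M k) P := fun k =>
    (hVi k).add (integrable_finsetSum _ fun j _ => hRi j)
  have hMa : StronglyAdapted ℱ M := fun k =>
    (hV k).add (Finset.stronglyMeasurable_fun_sum _ fun j hj =>
      (hR j).mono (ℱ.mono (Finset.mem_range.1 hj).le))
  have hsuper : Supermartingale M ℱ P := by
    refine supermartingale_of_setIntegral_succ_le hMa hMi fun k s hs => ?_
    have hsumi : ∀ k, Integrable (fun ω => ∑ j ∈ Finset.range k, R j ω) (P.restrict s) :=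
      fun k => (integrable_finsetSum _ fun j _ => hRi j).integrableOn
    have h1 : ∫ ω in s, M (k + 1) ω ∂P = ∫ ω in s, V (k + 1) ω ∂P +
        (∫ ω in s, ∑ j ∈ Finset.range k, R j ω ∂P + ∫ ω in s, R k ω ∂P) := by
      rw [← integral_add (hsumi k) (hRi k).integrableOn]
      simp only [M, Finset.sum_range_succ]
      exact integral_add (hVi _).integrableOn ((hsumi k).add (hRi k).integrableOn)
    have h2 : ∫ ω in s, M k ω ∂P = ∫ ω in s, V k ω ∂P +
        ∫ ω in s, ∑ j ∈ Finset.range k, R j ω ∂P :=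
      integral_add (hVi _).integrableOn (hsumi k)
    rw [h1, h2]
    linarith [h k s hs]
  have hbdd : ∀ k, eLpNorm ((-M) k) 1 P ≤ (Real.toNNReal (∫ ω, M 0 ω ∂P) : NNReal) := fun k => by
    have h1 := hsuper.setIntegral_le (Nat.zero_le k) (MeasurableSet.univ)
    rw [setIntegral_univ, setIntegral_univ] at h1
    rw [Pi.neg_apply, eLpNorm_neg, eLpNorm_one_eq_lintegral_enorm,
      ← ofReal_integral_norm_eq_lintegral_enorm (hMi k)]
    refine ENNReal.ofReal_le_ofReal (le_trans (le_of_eq ?_) h1)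
    exact integral_congr_ae (Eventually.of_forall fun ω => Real.norm_of_nonneg (hM0 k ω))
  filter_upwards [hsuper.neg.exists_ae_tendsto_of_bdd hbdd] with ω ⟨c, hc⟩
  have hMc : Tendsto (fun k => M k ω) atTop (𝓝 (-c)) := by simpa using hc.neg
  obtain ⟨B, hB⟩ := hMc.bddAbove_range
  have hsum : Summable fun j => R j ω := by
    refine summable_of_sum_range_le (c := B) (hR0 · ω) fun k => ?_
    have := hB ⟨k, rfl⟩
    have h2 := hV0 k ω
    simp only [M] at this
    linarith
  exact ⟨⟨_, (hMc.sub hsum.hasSum.tendsto_sum_nat).congr fun k => by simp [M]⟩,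
    hsum.tendsto_atTop_zero⟩

theorem setIntegral_indicator_eq_mul_of_indep {Ω : Type*} {m₁ m₂ mΩ : MeasurableSpace Ω}
    {P : Measure Ω} [IsProbabilityMeasure P] (h₁ : m₁ ≤ mΩ) (h₂ : m₂ ≤ mΩ) (hind : Indep m₁ m₂ P) {T s : Set Ω}
    (hT : MeasurableSet[m₁] T) (hs : MeasurableSet[m₂] s) {C : Ω → ℝ} (hC : Measurable[m₂] C) :
    ∫ ω in s, T.indicator C ω ∂P = P.real T * ∫ ω in s, C ω ∂P := by
  have hX : Measurable[m₁] (T.indicator (1 : Ω → ℝ)) := @Measurable.indicator _ _ _ _ m₁ _ _ (@measurable_one _ _ _ m₁ _) hT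
  have hY : Measurable[m₂] (s.indicator C) := hC.indicator hs
  have hXY : IndepFun (T.indicator (1 : Ω → ℝ)) (s.indicator C) P := by
    rw [IndepFun_iff_Indep]
    exact indep_of_indep_of_le_left (indep_of_indep_of_le_right hind hY.comap_le) hX.comap_le
  have := hXY.integral_fun_mul_eq_mul_integral (hX.mono h₁ le_rfl).aestronglyMeasurable
    (hY.mono h₂ le_rfl).aestronglyMeasurable
  rw [integral_indicator_one (h₁ _ hT), integral_indicator (h₂ _ hs)] at this
  rw [← this, ← integral_indicator (h₂ _ hs)]
  refine integral_congr_ae (Eventually.of_forall fun ω => ?_)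
  by_cases h1 : ω ∈ T <;> by_cases h2 : ω ∈ s <;> simp [h1, h2]

/-- This is $\mathbb E[C\mid m_2]=B+\mathbb P(T)(A-B)$ in integrated form: $C=B+1_T(A-B)$ with $1_T$
independent of $m_2$. -/
theorem setIntegral_ite_of_indep {Ω : Type*} {m₁ m₂ mΩ : MeasurableSpace Ω}
    {P : Measure Ω} [IsProbabilityMeasure P] (h₁ : m₁ ≤ mΩ) (h₂ : m₂ ≤ mΩ) (hind : Indep m₁ m₂ P) {T s : Set Ω}
    (hT : MeasurableSet[m₁] T) (hs : MeasurableSet[m₂] s) {A B C : Ω → ℝ}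
    (hA : Measurable[m₂] A) (hB : Measurable[m₂] B) (hAi : Integrable A P) (hBi : Integrable B P)
    (hCA : ∀ ω ∈ T, C ω = A ω) (hCB : ∀ ω ∉ T, C ω = B ω) :
    ∫ ω in s, C ω ∂P =
      ∫ ω in s, B ω ∂P + P.real T * (∫ ω in s, A ω ∂P - ∫ ω in s, B ω ∂P) := by
  have hC : C = fun ω => B ω + T.indicator (A - B) ω := by
    funext ω
    by_cases h : ω ∈ T
    · simp [h, hCA ω h]
    · simp [h, hCB ω h]
  rw [hC, integral_add hBi.integrableOn ((hAi.sub hBi).indicator (h₁ _ hT)).integrableOn,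
    setIntegral_indicator_eq_mul_of_indep h₁ h₂ hind hT hs (hA.sub hB)]
  simp only [Pi.sub_apply]
  rw [integral_sub hAi.integrableOn hBi.integrableOn]

/-- A trial that is independent of the past and fails with probability `q < 1` cannot fail at all
times from some time on, as long as the failures can be read off from the history. -/
theorem measure_iInter_eq_zero_of_indep {ℱ : Filtration ℕ mΩ} [IsProbabilityMeasure P]
    {m' : ℕ → MeasurableSpace Ω} (hind : ∀ k, Indep (m' k) (ℱ k) P) {G B : ℕ → Set Ω}
    (hG : ∀ k, MeasurableSet[ℱ k] (G k)) (hB : ∀ k, MeasurableSet[m' k] (B k))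
    (hGB : ∀ k, MeasurableSet[ℱ (k + 1)] (G k ∩ B k)) {q : ENNReal} (hq : q < 1)
    (hPB : ∀ k, P (B k) = q) (K : ℕ) : P (⋂ j, (G (K + j) ∩ B (K + j))) = 0 := by
  let H : ℕ → Set Ω := fun r => ⋂ j ∈ Finset.range r, (G (K + j) ∩ B (K + j))
  have hH : ∀ r, MeasurableSet[ℱ (K + r)] (H r) := fun r =>
    Finset.measurableSet_biInter _ fun j hj =>
      ℱ.mono (by have := Finset.mem_range.1 hj; omega) _ (hGB (K + j))
  have hle : ∀ r, P (H r) ≤ q ^ r := fun r => by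
    induction r with
    | zero => simpa using prob_le_one
    | succ r ih =>
      -- Only $G\cap B$ is assumed visible in the next history, not $B$. So independence is applied
      -- to $B$ against the past event $H_r\cap G$, and $G$ is then dropped.
      have hsub : H (r + 1) ⊆ B (K + r) ∩ (H r ∩ G (K + r)) := by
        intro ω hω
        simp only [H, Set.mem_iInter, Finset.mem_range] at hω ⊢
        refine ⟨(hω r (by omega)).2, ?_, (hω r (by omega)).1⟩
        simp only [Set.mem_iInter]
        exact fun j hj => hω j (by omega)
      calc P (H (r + 1)) ≤ P (B (K + r) ∩ (H r ∩ G (K + r))) := measure_mono hsub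
        _ = P (B (K + r)) * P (H r ∩ G (K + r)) :=
          (Indep_iff _ _ _).1 (hind (K + r)) _ _ (hB _) ((hH r).inter (hG _))
        _ ≤ q * q ^ r := by
          rw [hPB]
          exact mul_le_mul_right ((measure_mono Set.inter_subset_left).trans ih) _
        _ = q ^ (r + 1) := (pow_succ' q r).symm
  refine le_antisymm (ge_of_tendsto' (ENNReal.tendsto_pow_atTop_nhds_zero_of_lt_one hq) fun r =>
    (measure_mono ?_).trans (hle r)) zero_le
  intro ω hω
  simp only [H, Set.mem_iInter] at hω ⊢
  exact fun j _ => hω j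

end Probability

/-! ### The weighted Lyapunov function and pathwise convergence -/

section Lyapunov

variable {n N : ℕ} {f : Fin (N + 1) → EuclideanSpace ℝ (Fin n) → EReal}
  {g : Fin (N + 1) → EuclideanSpace ℝ (Fin n) → ℝ} {L : Fin (N + 1) → NNReal}
  {σ γ : ℝ} {α lam p : Fin N → ℝ}

/-- The Lyapunov function of the whole method, weighted by the inverse selection probabilities. -/
noncomputable def totalLyapunov (p lam α : Fin N → ℝ) (xs : EuclideanSpace ℝ (Fin n))
    (zs y z : Fin N → EuclideanSpace ℝ (Fin n)) : ℝ :=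
  ∑ i, (p i)⁻¹ * userLyapunov (lam i) (α i) xs (zs i) (y i) (z i)

theorem userLyapunov_nonneg {l a : ℝ} (hl : 0 ≤ l) (ha : 0 ≤ a)
    (xs zs y z : EuclideanSpace ℝ (Fin n)) : 0 ≤ userLyapunov l a xs zs y z := by
  unfold userLyapunov
  positivity

/-- A quasi-triangle inequality for changing the reference pair, from
$\|u-v\|^2\le2\|u-w\|^2+2\|v-w\|^2$. It transfers smallness from the countable dense set to the
cluster point. -/
theorem userLyapunov_le {l a : ℝ} (hl : 0 ≤ l) (ha : 0 ≤ a)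
    (xs zs xs' zs' y z : EuclideanSpace ℝ (Fin n)) :
    userLyapunov l a xs zs y z ≤
      2 * userLyapunov l a xs' zs' y z + 2 * userLyapunov l a xs' zs' xs zs := by
  have key : ∀ u v w : EuclideanSpace ℝ (Fin n),
      ‖u - v‖ ^ 2 ≤ 2 * ‖u - w‖ ^ 2 + 2 * ‖v - w‖ ^ 2 := fun u v w => by
    have h1 : ‖u - v‖ ≤ ‖u - w‖ + ‖v - w‖ := by
      have := norm_sub_le (u - w) (v - w)
      rwa [sub_sub_sub_cancel_right] at this
    nlinarith [norm_nonneg (u - v), sq_nonneg (‖u - w‖ - ‖v - w‖)]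
  have h1 := div_le_div_of_nonneg_right (key z zs zs') (by positivity : 0 ≤ 2 * l)
  have h2 := mul_le_mul_of_nonneg_left (key y xs xs') (by positivity : 0 ≤ a / 2)
  rw [add_div, mul_div_assoc, mul_div_assoc] at h1
  unfold userLyapunov
  linarith

theorem totalLyapunov_nonneg (hpar : IsAdmissible L σ γ α lam) (hp : ∀ i, 0 < p i)
    (xs : EuclideanSpace ℝ (Fin n)) (zs y z : Fin N → EuclideanSpace ℝ (Fin n)) :
    0 ≤ totalLyapunov p lam α xs zs y z :=
  Finset.sum_nonneg fun i _ => mul_nonneg (inv_nonneg.2 (hp i).le)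
    (userLyapunov_nonneg (hpar.lam_mem i).1.le (hpar.alpha_nonneg i) _ _ _ _)

theorem totalLyapunov_le (hpar : IsAdmissible L σ γ α lam) (hp : ∀ i, 0 < p i)
    (xs xs' : EuclideanSpace ℝ (Fin n)) (zs zs' y z : Fin N → EuclideanSpace ℝ (Fin n)) :
    totalLyapunov p lam α xs zs y z ≤ 2 * totalLyapunov p lam α xs' zs' y z +
      2 * totalLyapunov p lam α xs' zs' (fun _ => xs) zs := by
  unfold totalLyapunov
  rw [Finset.mul_sum, Finset.mul_sum, ← Finset.sum_add_distrib]
  refine Finset.sum_le_sum fun i _ => ?_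
  have := mul_le_mul_of_nonneg_left (userLyapunov_le (hpar.lam_mem i).1.le (hpar.alpha_nonneg i)
    xs (zs i) xs' (zs' i) (y i) (z i)) (inv_nonneg.2 (hp i).le)
  linarith

/-- The Lyapunov function controls the server iterate and the dual variables. -/
theorem exists_norm_sq_le_mul_totalLyapunov (hN : 1 ≤ N) (hfg : IsProblem f g L)
    (hpar : IsAdmissible L σ γ α lam) (hp : ∀ i, 0 < p i) :
    ∃ C : ℝ, ∀ (xs x : EuclideanSpace ℝ (Fin n)) (zs y z : Fin N → EuclideanSpace ℝ (Fin n)),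
      IsFixedPair f g σ γ α xs zs → IsServerStep f g σ γ α y z x →
        ‖x - xs‖ ^ 2 ≤ C * totalLyapunov p lam α xs zs y z ∧
        ∀ i, ‖z i - zs i‖ ^ 2 ≤ C * totalLyapunov p lam α xs zs y z := by
  have hN0 : (0 : ℝ) < N := by exact_mod_cast hN
  let c : Fin N → ℝ := fun i => 2 * lam i * p i + 2 * α i * p i
  have hc1 : ∀ i, 0 ≤ 2 * lam i * p i := fun i =>
    mul_nonneg (mul_nonneg (by norm_num) (hpar.lam_mem i).1.le) (hp i).le
  have hc2 : ∀ i, 0 ≤ 2 * α i * p i := fun i =>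
    mul_nonneg (mul_nonneg (by norm_num) (hpar.alpha_nonneg i)) (hp i).le
  have hcC : ∀ i, c i ≤ ∑ j, c j := fun i =>
    Finset.single_le_sum (fun j _ => add_nonneg (hc1 j) (hc2 j)) (Finset.mem_univ i)
  -- Both $\|z_i-z_i^*\|$ and $\alpha_i\|y_i-x^*\|$ are at most $\sqrt{V\sum_j c_j}$; the server
  -- estimate weights them by $1$ and $3$, and $(1+3)^2=16$.
  refine ⟨16 * ∑ i, c i, fun xs x zs y z hs hx => ?_⟩
  set V := totalLyapunov p lam α xs zs y z with hV
  have hV0 : 0 ≤ V := totalLyapunov_nonneg hpar hp _ _ _ _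
  have hC0 : 0 ≤ ∑ i, c i := Finset.sum_nonneg fun j _ => add_nonneg (hc1 j) (hc2 j)
  have hterm : ∀ i, (p i)⁻¹ * userLyapunov (lam i) (α i) xs (zs i) (y i) (z i) ≤ V := fun i =>
    Finset.single_le_sum (f := fun i => (p i)⁻¹ * userLyapunov (lam i) (α i) xs (zs i) (y i) (z i))
      (fun j _ => mul_nonneg (inv_nonneg.2 (hp j).le)
      (userLyapunov_nonneg (hpar.lam_mem j).1.le (hpar.alpha_nonneg j) _ _ _ _)) (Finset.mem_univ i)
  have hz : ∀ i, ‖z i - zs i‖ ^ 2 ≤ (∑ i, c i) * V := fun i => by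
    have hl := (hpar.lam_mem i).1
    have hpi := hp i
    have h1 := mul_le_mul_of_nonneg_left (hterm i) (hc1 i)
    have h2 : 2 * lam i * p i * ((p i)⁻¹ * userLyapunov (lam i) (α i) xs (zs i) (y i) (z i)) =
        ‖z i - zs i‖ ^ 2 + lam i * α i * ‖y i - xs‖ ^ 2 := by
      unfold userLyapunov
      field_simp
    have h3 : 0 ≤ lam i * α i * ‖y i - xs‖ ^ 2 :=
      mul_nonneg (mul_nonneg hl.le (hpar.alpha_nonneg i)) (sq_nonneg _)
    have h4 := mul_le_mul_of_nonneg_right (hcC i) hV0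
    have h5 := mul_nonneg (hc2 i) hV0
    simp only [c] at h4
    linarith
  have hy : ∀ i, (α i * ‖y i - xs‖) ^ 2 ≤ (∑ i, c i) * V := fun i => by
    have hl := (hpar.lam_mem i).1
    have ha := hpar.alpha_nonneg i
    have hpi := hp i
    have h1 := mul_le_mul_of_nonneg_left (hterm i) (hc2 i)
    have h2 : 2 * α i * p i * ((p i)⁻¹ * userLyapunov (lam i) (α i) xs (zs i) (y i) (z i)) =
        α i * (‖z i - zs i‖ ^ 2 / lam i) + (α i * ‖y i - xs‖) ^ 2 := by
      unfold userLyapunov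
      field_simp
    have h3 : 0 ≤ α i * (‖z i - zs i‖ ^ 2 / lam i) := by positivity
    have h4 := mul_le_mul_of_nonneg_right (hcC i) hV0
    have h5 := mul_nonneg (hc1 i) hV0
    simp only [c] at h4
    linarith
  have hCV : 0 ≤ (∑ i, c i) * V := mul_nonneg hC0 hV0
  refine ⟨?_, fun i => (hz i).trans (by linarith)⟩
  have h1 := hx.mul_norm_sub_le hfg hpar hs.1
  have h2 : ∑ i, (‖z i - zs i‖ + 3 * α i * ‖y i - xs‖) ≤
      ∑ _i : Fin N, 4 * √((∑ i, c i) * V) := Finset.sum_le_sum fun i _ => by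
    have e1 := Real.le_sqrt_of_sq_le (hz i)
    have e2 := Real.le_sqrt_of_sq_le (hy i)
    linarith
  rw [Finset.sum_const, Finset.card_univ, Fintype.card_fin, nsmul_eq_mul] at h2
  have h3 : ‖x - xs‖ ≤ 4 * √((∑ i, c i) * V) := le_of_mul_le_mul_left (h1.trans h2) hN0
  calc ‖x - xs‖ ^ 2 ≤ (4 * √((∑ i, c i) * V)) ^ 2 := by gcongr
    _ = 16 * (∑ i, c i) * V := by rw [mul_pow, Real.sq_sqrt hCV]; ring

/-- Quasi-Fejér monotonicity with respect to a dense set of stationary pairs yields convergence of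
the server iterates to the first component of a stationary pair. -/
theorem exists_isFixedPair_tendsto (hN : 1 ≤ N) (hfg : IsProblem f g L)
    (hpar : IsAdmissible L σ γ α lam) (hp : ∀ i, 0 < p i)
    {D : Set (EuclideanSpace ℝ (Fin n) × (Fin N → EuclideanSpace ℝ (Fin n)))}
    (hD : ∀ w ∈ D, IsFixedPair f g σ γ α w.1 w.2)
    (hDd : {w | IsFixedPair f g σ γ α w.1 w.2} ⊆ closure D)
    {x : ℕ → EuclideanSpace ℝ (Fin n)} {y z w : ℕ → Fin N → EuclideanSpace ℝ (Fin n)}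
    (hserver : ∀ k, IsServerStep f g σ γ α (y k) (z k) (x k))
    (huser : ∀ k i, IsUserStep (f i.castSucc) (g i.castSucc) σ γ (α i) (x k) (z k i) (w k i))
    (hV : ∀ v ∈ D, ∃ c, Tendsto (fun k => totalLyapunov p lam α v.1 v.2 (y k) (z k)) atTop (𝓝 c))
    (hw : ∀ i, Tendsto (fun k => ‖x k - w k i‖) atTop (𝓝 0))
    (hy : ∀ i, Tendsto (fun k => α i * ‖x k - y k i‖) atTop (𝓝 0)) :
    ∃ xs zs, IsFixedPair f g σ γ α xs zs ∧ Tendsto x atTop (𝓝 xs) := by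
  obtain ⟨C, hC⟩ := exists_norm_sq_le_mul_totalLyapunov hN hfg hpar hp
  obtain ⟨x₁, z₁, h₁⟩ := hfg.exists_isFixedPair (σ := σ) (α := α) hN hpar.gamma_pos
  obtain ⟨v, hvD⟩ : D.Nonempty := closure_nonempty_iff.1 ⟨(x₁, z₁), hDd h₁⟩
  obtain ⟨c, hc⟩ := hV v hvD
  obtain ⟨B, hB⟩ := (hc.const_mul C).bddAbove_range
  have hB' : ∀ k, C * totalLyapunov p lam α v.1 v.2 (y k) (z k) ≤ B := fun k => hB ⟨k, rfl⟩
  have hball : ∀ k, (x k, z k) ∈ Metric.closedBall v (√B) := fun k => by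
    have h := hC v.1 (x k) v.2 (y k) (z k) (hD v hvD) (hserver k)
    rw [Metric.mem_closedBall, Prod.dist_eq, max_le_iff]
    refine ⟨?_, (dist_pi_le_iff (Real.sqrt_nonneg _)).2 fun i => ?_⟩
    · rw [dist_eq_norm]
      exact Real.le_sqrt_of_sq_le (h.1.trans (hB' k))
    · rw [dist_eq_norm]
      exact Real.le_sqrt_of_sq_le ((h.2 i).trans (hB' k))
  obtain ⟨⟨xs, zs⟩, -, φ, hφ, hlim⟩ :=
    tendsto_subseq_of_bounded Metric.isBounded_closedBall hball
  have hxφ : Tendsto (fun k => x (φ k)) atTop (𝓝 xs) := (continuous_fst.tendsto _).comp hlim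
  have hzφ : ∀ i, Tendsto (fun k => z (φ k) i) atTop (𝓝 (zs i)) := fun i =>
    (((continuous_apply i).comp continuous_snd).tendsto (xs, zs)).comp hlim
  have hwφ : ∀ i, Tendsto (fun k => w (φ k) i) atTop (𝓝 xs) := fun i => by
    have := hxφ.sub (tendsto_zero_iff_norm_tendsto_zero.2 ((hw i).comp hφ.tendsto_atTop))
    simpa using this
  have hfix : IsFixedPair f g σ γ α xs zs :=
    isFixedPair_of_tendsto hfg hpar (fun k => hserver (φ k)) (fun k => huser (φ k)) hxφ hzφ hwφ
      fun i => (hy i).comp hφ.tendsto_atTop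
  -- If $\alpha_i=0$ the $y_i$-term is absent from the Lyapunov function; otherwise $y_i$ follows
  -- $x$ along the subsequence.
  have hyφ : ∀ (v : EuclideanSpace ℝ (Fin n)) i, Tendsto (fun k => α i / 2 * ‖y (φ k) i - v‖ ^ 2)
      atTop (𝓝 (α i / 2 * ‖xs - v‖ ^ 2)) := fun v i => by
    rcases eq_or_ne (α i) 0 with h0 | h0
    · simp [h0]
    · have h1 : Tendsto (fun k => ‖x (φ k) - y (φ k) i‖) atTop (𝓝 0) := by
        have := ((hy i).comp hφ.tendsto_atTop).const_mul (α i)⁻¹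
        simpa [h0] using this
      have h2 : Tendsto (fun k => y (φ k) i) atTop (𝓝 xs) := by
        simpa using hxφ.sub (tendsto_zero_iff_norm_tendsto_zero.2 h1)
      exact ((h2.sub_const v).norm.pow 2).const_mul _
  have hVφ : ∀ v : EuclideanSpace ℝ (Fin n) × (Fin N → EuclideanSpace ℝ (Fin n)),
      Tendsto (fun k => totalLyapunov p lam α v.1 v.2 (y (φ k)) (z (φ k))) atTop
        (𝓝 (totalLyapunov p lam α v.1 v.2 (fun _ => xs) zs)) := fun v => by
    unfold totalLyapunov userLyapunov
    exact tendsto_finsetSum _ fun i _ => Tendsto.const_mul _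
      (((((hzφ i).sub_const _).norm.pow 2).div_const _).add (hyφ _ i))
  -- Convergence is known only for references in $D$. A $v\in D$ near the cluster pair has limit
  -- value below $\varepsilon/4$, and changing the reference doubles two such terms.
  have hV0 : Tendsto (fun k => totalLyapunov p lam α xs zs (y k) (z k)) atTop (𝓝 0) := by
    rw [Metric.tendsto_atTop]
    intro ε hε
    have hcont : Continuous fun v : EuclideanSpace ℝ (Fin n) × (Fin N → EuclideanSpace ℝ (Fin n)) =>
        totalLyapunov p lam α v.1 v.2 (fun _ => xs) zs := by
      unfold totalLyapunov userLyapunov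
      fun_prop
    have hzero : totalLyapunov p lam α xs zs (fun _ => xs) zs = 0 := by
      simp [totalLyapunov, userLyapunov]
    have hopen : {v : EuclideanSpace ℝ (Fin n) × (Fin N → EuclideanSpace ℝ (Fin n)) |
        totalLyapunov p lam α v.1 v.2 (fun _ => xs) zs < ε / 4} ∈ 𝓝 (xs, zs) :=
      (isOpen_lt hcont continuous_const).mem_nhds (by
        rw [Set.mem_ofPred_eq, hzero]
        positivity)
    obtain ⟨v, hv, hvD⟩ := mem_closure_iff_nhds.1 (hDd (show (xs, zs) ∈ _ from hfix)) _ hopen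
    obtain ⟨c, hc⟩ := hV v hvD
    have hcv := tendsto_nhds_unique (hc.comp hφ.tendsto_atTop) (hVφ v)
    rw [hcv] at hc
    obtain ⟨K, hK⟩ := eventually_atTop.1 (hc.eventually_lt_const hv)
    refine ⟨K, fun k hk => ?_⟩
    rw [dist_zero_right, Real.norm_of_nonneg (totalLyapunov_nonneg hpar hp _ _ _ _)]
    have h1 := totalLyapunov_le hpar hp xs v.1 zs v.2 (y k) (z k)
    have h2 := hK k hk
    have h3 : totalLyapunov p lam α v.1 v.2 (fun _ => xs) zs < ε / 4 := hv
    linarith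
  refine ⟨xs, zs, hfix, ?_⟩
  rw [tendsto_iff_norm_sub_tendsto_zero]
  have hsq : Tendsto (fun k => ‖x k - xs‖ ^ 2) atTop (𝓝 0) :=
    squeeze_zero (fun k => sq_nonneg _)
      (fun k => (hC xs (x k) zs (y k) (z k) hfix (hserver k)).1) (by simpa using hV0.const_mul C)
  simpa [Real.sqrt_sq (norm_nonneg _)] using hsq.sqrt

/-- A sequence that is refreshed infinitely often by a convergent sequence, and otherwise constant,
converges. -/
theorem tendsto_of_frequently_refreshed {T : Type*} [TopologicalSpace T] {u v : ℕ → T} {a : T}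
    (hv : Tendsto v atTop (𝓝 a)) (huv : ∀ k, u (k + 1) = u k ∨ u (k + 1) = v k)
    (hinf : ∀ K, ∃ j, u (K + j + 1) = v (K + j)) : Tendsto u atTop (𝓝 a) := by
  intro U hU
  obtain ⟨K, hK⟩ := eventually_atTop.1 (hv hU)
  obtain ⟨j, hj⟩ := hinf K
  refine mem_map.2 (mem_atTop_sets.2 ⟨K + j + 1, fun k hk => ?_⟩)
  induction k, hk using Nat.le_induction with
  | base =>
    rw [Set.mem_preimage, hj]
    exact hK _ (Nat.le_add_right _ _)
  | succ k hk ih =>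
    rw [Set.mem_preimage]
    rcases huv k with h | h
    · rw [h]; exact ih
    · rw [h]; exact hK k (by omega)

end Lyapunov

/-! ### The random trajectory: measurability, expected decrease, convergence -/

section RandomRun

variable {n N : ℕ} {Ω : Type*}

/-- The random trajectory of the method in inclusion form, with `w k` the virtual user updates and
`x k` the server iterate of iteration `k`. -/
structure IsInclusionRun (f : Fin (N + 1) → EuclideanSpace ℝ (Fin n) → EReal)
    (g : Fin (N + 1) → EuclideanSpace ℝ (Fin n) → ℝ) (σ γ : ℝ) (α lam : Fin N → ℝ)
    (y0 z0 : Fin N → EuclideanSpace ℝ (Fin n)) (S : ℕ → Ω → Finset (Fin N))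
    (x : ℕ → Ω → EuclideanSpace ℝ (Fin n)) (y z w : ℕ → Ω → Fin N → EuclideanSpace ℝ (Fin n)) :
    Prop where
  init_y : ∀ ω, y 0 ω = y0
  init_z : ∀ ω, z 0 ω = z0
  server : ∀ k ω, IsServerStep f g σ γ α (y k ω) (z k ω) (x k ω)
  user : ∀ k ω i,
    IsUserStep (f i.castSucc) (g i.castSucc) σ γ (α i) (x k ω) (z k ω i) (w k ω i)
  active_y : ∀ k ω, ∀ i ∈ S k ω, y (k + 1) ω i = w k ω i
  active_z : ∀ k ω, ∀ i ∈ S k ω, z (k + 1) ω i = z k ω i + lam i • (w k ω i - x k ω)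
  idle_y : ∀ k ω, ∀ i ∉ S k ω, y (k + 1) ω i = y k ω i
  idle_z : ∀ k ω, ∀ i ∉ S k ω, z (k + 1) ω i = z k ω i

variable {f : Fin (N + 1) → EuclideanSpace ℝ (Fin n) → EReal}
  {g : Fin (N + 1) → EuclideanSpace ℝ (Fin n) → ℝ} {L : Fin (N + 1) → NNReal}
  {σ γ : ℝ} {α lam p : Fin N → ℝ} {y0 z0 : Fin N → EuclideanSpace ℝ (Fin n)}
  {S : ℕ → Ω → Finset (Fin N)} {x : ℕ → Ω → EuclideanSpace ℝ (Fin n)}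
  {y z w : ℕ → Ω → Fin N → EuclideanSpace ℝ (Fin n)}

namespace IsInclusionRun

/-- The sequences $x$ and $\tilde y$ are shifted by one, so that everything with index $k$ is a
function of the state $(y^k,z^k)$. -/
theorem of_isSDRSM (hN : 1 ≤ N) (hfg : IsProblem f g L) (hpar : IsAdmissible L σ γ α lam)
    (hrun : ∀ ω, IsSDRSM f g σ γ α lam y0 z0 (fun k => S k ω) (fun k => x k ω)
      (fun k => y k ω) (fun k => z k ω))
    (hvirt : ∀ ω, IsVirtual f g σ γ α (fun k => x k ω) (fun k => z k ω) (fun k => w k ω)) :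
    IsInclusionRun f g σ γ α lam y0 z0 S (fun k => x (k + 1)) y z (fun k => w (k + 1)) := by
  have huser : ∀ k ω i, IsUserStep (f i.castSucc) (g i.castSucc) σ γ (α i) (x (k + 1) ω)
      (z k ω i) (w (k + 1) ω i) := fun k ω i =>
    (hfg.gammaZero _).isUserStep_of_isProx hpar.gamma_pos (hvirt ω k i)
  have hy : ∀ k ω, ∀ i ∈ S k ω, y (k + 1) ω i = w (k + 1) ω i := fun k ω i hi =>
    ((hfg.gammaZero _).isUserStep_of_isProx hpar.gamma_pos ((hrun ω).user_y k i hi)).eq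
      hpar.gamma_pos (hpar.alpha_nonneg i) (huser k ω i)
  exact
    { init_y := fun ω => (hrun ω).init_y
      init_z := fun ω => (hrun ω).init_z
      server := fun k ω =>
        (hfg.gammaZero _).isServerStep_of_isProx hN hpar.gamma_pos ((hrun ω).server k)
      user := huser
      active_y := hy
      active_z := fun k ω i hi => by
        rw [← hy k ω i hi]
        exact (hrun ω).user_z k i hi
      idle_y := fun k ω => (hrun ω).idle_y k
      idle_z := fun k ω => (hrun ω).idle_z k }

theorem x_eq (h : IsInclusionRun f g σ γ α lam y0 z0 S x y z w) (hN : 1 ≤ N)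
    (hfg : IsProblem f g L) (hpar : IsAdmissible L σ γ α lam) {k : ℕ} {ω ω' : Ω}
    (hs : (y k ω, z k ω) = (y k ω', z k ω')) : x k ω = x k ω' := by
  have h1 := h.server k ω
  rw [(Prod.mk.inj hs).1, (Prod.mk.inj hs).2] at h1
  exact h1.eq hN hfg hpar (h.server k ω')

theorem w_eq (h : IsInclusionRun f g σ γ α lam y0 z0 S x y z w) (hN : 1 ≤ N)
    (hfg : IsProblem f g L) (hpar : IsAdmissible L σ γ α lam) {k : ℕ} {ω ω' : Ω}
    (hs : (y k ω, z k ω) = (y k ω', z k ω')) : w k ω = w k ω' := by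
  funext i
  have h1 := h.user k ω i
  rw [(Prod.mk.inj hs).2, h.x_eq hN hfg hpar hs] at h1
  exact h1.eq hpar.gamma_pos (hpar.alpha_nonneg i) (h.user k ω' i)

/-- The state after `k` iterations takes finitely many values and is measurable. -/
theorem finite_range_and_measurable [MeasurableSpace Ω]
    (h : IsInclusionRun f g σ γ α lam y0 z0 S x y z w) (hN : 1 ≤ N)
    (hfg : IsProblem f g L) (hpar : IsAdmissible L σ γ α lam)
    (hS : ∀ k i, MeasurableSet {ω | i ∈ S k ω}) (k : ℕ) :
    (Set.range fun ω => (y k ω, z k ω)).Finite ∧ Measurable fun ω => (y k ω, z k ω) := by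
  induction k with
  | zero =>
    simp only [h.init_y, h.init_z]
    exact ⟨(Set.finite_singleton (y0, z0)).subset (by rintro _ ⟨_, rfl⟩; rfl), measurable_const⟩
  | succ k ih =>
    -- State and selection together determine the next state. The selection is encoded by its
    -- membership predicates, since the events $\{i\in S_k\}$ are what is known to be measurable.
    let s : Ω → ((Fin N → EuclideanSpace ℝ (Fin n)) × (Fin N → EuclideanSpace ℝ (Fin n))) ×
      (Fin N → Prop) := fun ω => ((y k ω, z k ω), fun i => i ∈ S k ω)
    have hfin : (Set.range s).Finite :=
      (ih.1.prod (Set.finite_univ (α := Fin N → Prop))).subset (by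
        rintro _ ⟨ω, rfl⟩
        exact ⟨⟨ω, rfl⟩, Set.mem_univ _⟩)
    have hmeas : Measurable s :=
      ih.2.prodMk (measurable_pi_iff.2 fun i => measurableSet_setOfPred.1 (hS k i))
    have hfac : ∀ ω ω', s ω = s ω' → (y (k + 1) ω, z (k + 1) ω) = (y (k + 1) ω', z (k + 1) ω') := by
      intro ω ω' hs
      obtain ⟨hs1, hs2⟩ := Prod.mk.inj hs
      have hx := h.x_eq hN hfg hpar hs1
      have hw := h.w_eq hN hfg hpar hs1
      obtain ⟨hy, hz⟩ := Prod.mk.inj hs1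
      have hi : ∀ i, i ∈ S k ω ↔ i ∈ S k ω' := fun i => (congrFun hs2 i).to_iff
      refine Prod.ext (funext fun i => ?_) (funext fun i => ?_)
      · by_cases hiS : i ∈ S k ω
        · simp only
          rw [h.active_y k ω i hiS, h.active_y k ω' i ((hi i).1 hiS), hw]
        · simp only
          rw [h.idle_y k ω i hiS, h.idle_y k ω' i (mt (hi i).2 hiS), hy]
      · by_cases hiS : i ∈ S k ω
        · simp only
          rw [h.active_z k ω i hiS, h.active_z k ω' i ((hi i).1 hiS), hw, hx, hz]
        · simp only
          rw [h.idle_z k ω i hiS, h.idle_z k ω' i (mt (hi i).2 hiS), hz]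
    exact ⟨finite_range_of_factors_through hfin hfac,
      measurable_of_factors_through_finite_range hmeas hfin hfac⟩

end IsInclusionRun

/-- The history of a measurable process as a filtration. -/
def historyFiltration [mΩ : MeasurableSpace Ω]
    (y z : ℕ → Ω → Fin N → EuclideanSpace ℝ (Fin n)) (hy : ∀ k, Measurable (y k))
    (hz : ∀ k, Measurable (z k)) : Filtration ℕ mΩ where
  seq := history y z
  mono' := fun _ _ hij => biSup_mono fun _ hk => le_trans hk hij
  le' := fun _ => iSup₂_le fun j _ => sup_le (hy j).comap_le (hz j).comap_le

theorem measurable_history (y z : ℕ → Ω → Fin N → EuclideanSpace ℝ (Fin n)) (k : ℕ) :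
    Measurable[history y z k] fun ω => (y k ω, z k ω) := by
  have hle : MeasurableSpace.comap (y k) inferInstance ⊔ MeasurableSpace.comap (z k) inferInstance ≤
      history y z k :=
    le_iSup₂_of_le (f := fun j (_ : j ∈ Set.Iic k) => MeasurableSpace.comap (y j) inferInstance ⊔
      MeasurableSpace.comap (z j) inferInstance) k Set.self_mem_Iic le_rfl
  exact Measurable.prodMk
    (measurable_iff_comap_le.2 (le_sup_left.trans hle))
    (measurable_iff_comap_le.2 (le_sup_right.trans hle))

namespace IsInclusionRun

/-- Almost surely the Lyapunov function with respect to a given stationary pair converges and the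
residuals vanish. -/
theorem ae_tendsto_totalLyapunov [MeasurableSpace Ω] {P : Measure Ω} [IsProbabilityMeasure P]
    (h : IsInclusionRun f g σ γ α lam y0 z0 S x y z w) (hN : 1 ≤ N)
    (hfg : IsProblem f g L) (hpar : IsAdmissible L σ γ α lam) (hS : IsSampling P S p y z)
    {xs : EuclideanSpace ℝ (Fin n)} {zs : Fin N → EuclideanSpace ℝ (Fin n)}
    (hs : IsFixedPair f g σ γ α xs zs) :
    ∀ᵐ ω ∂P, (∃ c, Tendsto (fun k => totalLyapunov p lam α xs zs (y k ω) (z k ω)) atTop (𝓝 c)) ∧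
      Tendsto (fun k => ∑ i, ((α i / 2 - γ * ((L (Fin.last N) : ℝ) / N + σ * L i.castSucc) / 4) *
          ‖x k ω - y k ω i‖ ^ 2 + (1 + α i / 2 - lam i / 2 - (1 - σ) * γ * L i.castSucc / 4) *
          ‖x k ω - w k ω i‖ ^ 2)) atTop (𝓝 0) := by
  have hst := h.finite_range_and_measurable hN hfg hpar hS.measurable
  have hle : ∀ k, history y z k ≤ ‹MeasurableSpace Ω› :=
    (historyFiltration y z (fun k => (hst k).2.fst) (fun k => (hst k).2.snd)).le
  have hmeas : ∀ k {F : Ω → ℝ}, (∀ ω ω', (y k ω, z k ω) = (y k ω', z k ω') → F ω = F ω') →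
      Measurable[history y z k] F := fun k F hF =>
    @measurable_of_factors_through_finite_range Ω (history y z k) _ _ _ _ _ _ _
      (measurable_history y z k) (hst k).1 hF
  have hint : ∀ k {F : Ω → ℝ}, (∀ ω ω', (y k ω, z k ω) = (y k ω', z k ω') → F ω = F ω') →
      Integrable F P := fun k F hF =>
    integrable_of_finite_range ((hmeas k hF).mono (hle k) le_rfl)
      (finite_range_of_factors_through (hst k).1 hF)
  have hVfac : ∀ k ω ω', (y k ω, z k ω) = (y k ω', z k ω') →
      totalLyapunov p lam α xs zs (y k ω) (z k ω) =
        totalLyapunov p lam α xs zs (y k ω') (z k ω') := fun k ω ω' hω => by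
    rw [(Prod.mk.inj hω).1, (Prod.mk.inj hω).2]
  have hRfac : ∀ k ω ω', (y k ω, z k ω) = (y k ω', z k ω') →
      ∑ i, ((α i / 2 - γ * ((L (Fin.last N) : ℝ) / N + σ * L i.castSucc) / 4) *
          ‖x k ω - y k ω i‖ ^ 2 + (1 + α i / 2 - lam i / 2 - (1 - σ) * γ * L i.castSucc / 4) *
          ‖x k ω - w k ω i‖ ^ 2) =
      ∑ i, ((α i / 2 - γ * ((L (Fin.last N) : ℝ) / N + σ * L i.castSucc) / 4) *
          ‖x k ω' - y k ω' i‖ ^ 2 + (1 + α i / 2 - lam i / 2 - (1 - σ) * γ * L i.castSucc / 4) *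
          ‖x k ω' - w k ω' i‖ ^ 2) := fun k ω ω' hω => by
    rw [h.x_eq hN hfg hpar hω, h.w_eq hN hfg hpar hω, (Prod.mk.inj hω).1]
  refine ae_tendsto_of_setIntegral_succ_le
    (ℱ := historyFiltration y z (fun k => (hst k).2.fst) (fun k => (hst k).2.snd))
    (V := fun k ω => totalLyapunov p lam α xs zs (y k ω) (z k ω))
    (R := fun k ω => ∑ i, ((α i / 2 - γ * ((L (Fin.last N) : ℝ) / N + σ * L i.castSucc) / 4) *
          ‖x k ω - y k ω i‖ ^ 2 + (1 + α i / 2 - lam i / 2 - (1 - σ) * γ * L i.castSucc / 4) *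
          ‖x k ω - w k ω i‖ ^ 2))
    (fun k => (hmeas k (hVfac k)).stronglyMeasurable)
    (fun k => (hmeas k (hRfac k)).stronglyMeasurable)
    (fun k => hint k (hVfac k)) (fun k => hint k (hRfac k))
    (fun k ω => totalLyapunov_nonneg hpar hS.pos _ _ _ _)
    (fun k ω => Finset.sum_nonneg fun i _ => add_nonneg
      (mul_nonneg (hpar.server_coeff_nonneg i) (sq_nonneg _))
      (mul_nonneg (hpar.user_coeff_pos i).le (sq_nonneg _))) fun k s hsm => ?_
  -- The user's Lyapunov value if updated ($A$), if idle ($B$), and as realized ($C$). The first two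
  -- depend only on the state at time $k$, so selection enters $C$ only through an independent
  -- choice between them.
  let A : Fin N → Ω → ℝ := fun i ω =>
    userLyapunov (lam i) (α i) xs (zs i) (w k ω i) (z k ω i + lam i • (w k ω i - x k ω))
  let B : Fin N → Ω → ℝ := fun i ω => userLyapunov (lam i) (α i) xs (zs i) (y k ω i) (z k ω i)
  let C : Fin N → Ω → ℝ := fun i ω =>
    userLyapunov (lam i) (α i) xs (zs i) (y (k + 1) ω i) (z (k + 1) ω i)
  have hAfac : ∀ i ω ω', (y k ω, z k ω) = (y k ω', z k ω') → A i ω = A i ω' := fun i ω ω' hω => by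
    simp only [A]
    rw [h.x_eq hN hfg hpar hω, h.w_eq hN hfg hpar hω, (Prod.mk.inj hω).2]
  have hBfac : ∀ i ω ω', (y k ω, z k ω) = (y k ω', z k ω') → B i ω = B i ω' := fun i ω ω' hω => by
    simp only [B]
    rw [(Prod.mk.inj hω).1, (Prod.mk.inj hω).2]
  have hCfac : ∀ i ω ω', (y (k + 1) ω, z (k + 1) ω) = (y (k + 1) ω', z (k + 1) ω') →
      C i ω = C i ω' := fun i ω ω' hω => by
    simp only [C]
    rw [(Prod.mk.inj hω).1, (Prod.mk.inj hω).2]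
  have hAi : ∀ i, Integrable (A i) P := fun i => hint k (hAfac i)
  have hBi : ∀ i, Integrable (B i) P := fun i => hint k (hBfac i)
  have hCi : ∀ i, Integrable (C i) P := fun i => hint (k + 1) (hCfac i)
  have hSle : MeasurableSpace.comap (S k) ⊤ ≤ ‹MeasurableSpace Ω› := by
    rintro _ ⟨T, -, rfl⟩
    have : S k ⁻¹' T = ⋃ U ∈ T, ⋂ i, {ω | i ∈ S k ω ↔ i ∈ U} := by
      ext ω
      simp only [Set.mem_preimage, Set.mem_iUnion, Set.mem_iInter, Set.mem_ofPred_eq, exists_prop]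
      exact ⟨fun hω => ⟨_, hω, fun _ => Iff.rfl⟩, fun ⟨U, hU, hi⟩ => by rwa [Finset.ext hi]⟩
    rw [this]
    refine MeasurableSet.biUnion (Set.to_countable T) fun U _ => MeasurableSet.iInter fun i => ?_
    by_cases hiU : i ∈ U
    · simpa [hiU] using hS.measurable k i
    · have : {ω | i ∈ S k ω ↔ i ∈ U} = {ω | i ∈ S k ω}ᶜ := by
        ext ω
        simp [hiU]
      rw [this]
      exact (hS.measurable k i).compl
  have hC : ∀ i, ∫ ω in s, C i ω ∂P =
      ∫ ω in s, B i ω ∂P + p i * (∫ ω in s, A i ω ∂P - ∫ ω in s, B i ω ∂P) := fun i => by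
    rw [← hS.prob k i]
    refine setIntegral_ite_of_indep hSle (hle k) (hS.indep k) ⟨{U | i ∈ U}, trivial, rfl⟩ hsm
      (hmeas k (hAfac i)) (hmeas k (hBfac i)) (hAi i) (hBi i) (fun ω hω => ?_) (fun ω hω => ?_)
    · simp only [A, C]
      rw [h.active_y k ω i hω, h.active_z k ω i hω]
    · simp only [B, C]
      rw [h.idle_y k ω i hω, h.idle_z k ω i hω]
  have e1 : ∫ ω in s, totalLyapunov p lam α xs zs (y (k + 1) ω) (z (k + 1) ω) ∂P =
      ∑ i, (p i)⁻¹ * ∫ ω in s, C i ω ∂P := by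
    simp only [totalLyapunov, ← integral_const_mul]
    exact integral_finsetSum _ fun i _ => ((hCi i).const_mul _).integrableOn
  have e2 : ∫ ω in s, totalLyapunov p lam α xs zs (y k ω) (z k ω) ∂P =
      ∑ i, (p i)⁻¹ * ∫ ω in s, B i ω ∂P := by
    simp only [totalLyapunov, ← integral_const_mul]
    exact integral_finsetSum _ fun i _ => ((hBi i).const_mul _).integrableOn
  -- The weights $1/p_i$ cancel the selection probabilities, leaving the change produced by a full
  -- virtual sweep.
  have e3 : ∑ i, (p i)⁻¹ * ∫ ω in s, C i ω ∂P = ∑ i, (p i)⁻¹ * ∫ ω in s, B i ω ∂P +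
      (∫ ω in s, ∑ i, A i ω ∂P - ∫ ω in s, ∑ i, B i ω ∂P) := by
    rw [integral_finsetSum _ fun i _ => (hAi i).integrableOn,
      integral_finsetSum _ fun i _ => (hBi i).integrableOn, ← Finset.sum_sub_distrib,
      ← Finset.sum_add_distrib]
    refine Finset.sum_congr rfl fun i _ => ?_
    rw [hC i, mul_add, inv_mul_cancel_left₀ (hS.pos i).ne']
  have hAs : Integrable (fun ω => ∑ i, A i ω) P := integrable_finsetSum _ fun i _ => hAi i
  have hBs : Integrable (fun ω => ∑ i, B i ω) P := integrable_finsetSum _ fun i _ => hBi i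
  have e4 := setIntegral_mono (s := s) hAs.integrableOn
    (hBs.sub (hint k (hRfac k))).integrableOn fun ω =>
      hs.sum_userLyapunov_le hfg hpar (h.server k ω) (h.user k ω)
  simp only [Pi.sub_apply] at e4
  rw [integral_sub hBs.integrableOn (hint k (hRfac k)).integrableOn] at e4
  rw [e1, e2, e3]
  linarith

/-- Almost surely every user is refreshed after every time, up to updates that leave it unchanged. -/
theorem ae_frequently_refreshed [MeasurableSpace Ω] {P : Measure Ω} [IsProbabilityMeasure P]
    (h : IsInclusionRun f g σ γ α lam y0 z0 S x y z w) (hN : 1 ≤ N)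
    (hfg : IsProblem f g L) (hpar : IsAdmissible L σ γ α lam) (hS : IsSampling P S p y z)
    (i : Fin N) : ∀ᵐ ω ∂P, ∀ K, ∃ j, y (K + j + 1) ω i = w (K + j) ω i := by
  have hst := h.finite_range_and_measurable hN hfg hpar hS.measurable
  let ℱ := historyFiltration y z (fun k => (hst k).2.fst) (fun k => (hst k).2.snd)
  have hymeas : ∀ k, Measurable[ℱ k] fun ω => y k ω i := fun k =>
    (measurable_pi_apply i).comp (measurable_fst.comp (measurable_history y z k))
  have hwmeas : ∀ k, Measurable[ℱ k] fun ω => w k ω i := fun k =>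
    @measurable_of_factors_through_finite_range Ω (history y z k) _ _ _ _ _ _ _
      (measurable_history y z k) (hst k).1 fun ω ω' hω => by rw [h.w_eq hN hfg hpar hω]
  have hG : ∀ k, MeasurableSet[ℱ k] {ω | w k ω i ≠ y k ω i} := fun k =>
    (measurableSet_eq_fun (hwmeas k) (hymeas k)).compl
  rw [ae_all_iff]
  intro K
  rw [ae_iff]
  refine measure_mono_null ?_ (measure_iInter_eq_zero_of_indep (ℱ := ℱ) (P := P)
    (m' := fun k => MeasurableSpace.comap (S k) ⊤) hS.indep
    (G := fun k => {ω | w k ω i ≠ y k ω i}) (B := fun k => {ω | i ∉ S k ω}) hG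
    (fun k => ⟨{U | i ∉ U}, trivial, rfl⟩) (fun k => ?_) (q := ENNReal.ofReal (1 - p i)) ?_ ?_ K)
  · intro ω hω
    simp only [Set.mem_ofPred_eq, not_exists] at hω
    simp only [Set.mem_iInter]
    intro j
    have hnot : i ∉ S (K + j) ω := fun hi => hω j (h.active_y _ _ _ hi)
    refine ⟨fun heq => hω j ?_, hnot⟩
    rw [h.idle_y _ _ _ hnot, heq]
  -- The history does not record $S_k$, but when $\tilde y_i\ne y_i$, being idle is the same as
  -- $y_i$ not moving. When $\tilde y_i=y_i$, an idle user counts as refreshed anyway.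
  · have : {ω | w k ω i ≠ y k ω i} ∩ {ω | i ∉ S k ω} =
        {ω | w k ω i ≠ y k ω i} ∩ {ω | y (k + 1) ω i = y k ω i} := by
      ext ω
      refine and_congr_right fun hne => ⟨fun hi => h.idle_y k ω i hi, fun heq hi => hne ?_⟩
      rw [← h.active_y k ω i hi]
      exact heq
    rw [this]
    have hmono := ℱ.mono (Nat.le_succ k)
    exact (hmono _ (hG k)).inter (measurableSet_eq_fun (hymeas (k + 1))
      ((hymeas k).mono hmono le_rfl))
  · rw [ENNReal.ofReal_lt_one]
    linarith [hS.pos i]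
  · intro k
    have h1 : P.real {ω | i ∈ S k ω}ᶜ = 1 - p i := by
      rw [probReal_compl_eq_one_sub (hS.measurable k i), hS.prob]
    rw [← h1, ofReal_measureReal]
    rfl

/-- Almost sure convergence of the method. -/
theorem ae_tendsto [MeasurableSpace Ω] {P : Measure Ω} [IsProbabilityMeasure P]
    (h : IsInclusionRun f g σ γ α lam y0 z0 S x y z w) (hN : 1 ≤ N)
    (hfg : IsProblem f g L) (hpar : IsAdmissible L σ γ α lam) (hS : IsSampling P S p y z) :
    ∀ᵐ ω ∂P, (∃ xs ∈ argminSet (objective f g), Tendsto (fun k => x k ω) atTop (𝓝 xs)) ∧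
      (∀ i, Tendsto (fun k => ‖x k ω - y k ω i‖) atTop (𝓝 0)) ∧
      ∀ i, Tendsto (fun k => ‖x k ω - w k ω i‖) atTop (𝓝 0) := by
  -- Countability of $D$ allows a single null set for all reference pairs.
  obtain ⟨D, hD, hDc, hDd⟩ := (TopologicalSpace.IsSeparable.of_separableSpace
    {v : EuclideanSpace ℝ (Fin n) × (Fin N → EuclideanSpace ℝ (Fin n)) |
      IsFixedPair f g σ γ α v.1 v.2}).exists_countable_dense_subset
  obtain ⟨x₁, z₁, h₁⟩ := hfg.exists_isFixedPair (σ := σ) (α := α) hN hpar.gamma_pos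
  have hae : ∀ᵐ ω ∂P, ∀ v ∈ D, ∃ c,
      Tendsto (fun k => totalLyapunov p lam α v.1 v.2 (y k ω) (z k ω)) atTop (𝓝 c) :=
    (ae_ball_iff hDc).2 fun v hv =>
      (h.ae_tendsto_totalLyapunov hN hfg hpar hS (hD hv)).mono fun ω hω => hω.1
  filter_upwards [hae, h.ae_tendsto_totalLyapunov hN hfg hpar hS h₁,
    ae_all_iff.2 (h.ae_frequently_refreshed hN hfg hpar hS)] with ω hV hR hrefresh
  have hterm := hR.2
  have hsq : ∀ i, Tendsto (fun k =>
      (α i / 2 - γ * ((L (Fin.last N) : ℝ) / N + σ * L i.castSucc) / 4) * ‖x k ω - y k ω i‖ ^ 2 +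
      (1 + α i / 2 - lam i / 2 - (1 - σ) * γ * L i.castSucc / 4) * ‖x k ω - w k ω i‖ ^ 2)
      atTop (𝓝 0) := fun i => by
    have hnn : ∀ k i, 0 ≤
        (α i / 2 - γ * ((L (Fin.last N) : ℝ) / N + σ * L i.castSucc) / 4) * ‖x k ω - y k ω i‖ ^ 2 +
        (1 + α i / 2 - lam i / 2 - (1 - σ) * γ * L i.castSucc / 4) * ‖x k ω - w k ω i‖ ^ 2 :=
      fun k i => add_nonneg (mul_nonneg (hpar.server_coeff_nonneg i) (sq_nonneg _))
        (mul_nonneg (hpar.user_coeff_pos i).le (sq_nonneg _))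
    exact squeeze_zero (fun k => hnn k i) (fun k =>
      Finset.single_le_sum (f := fun i => (α i / 2 - γ * ((L (Fin.last N) : ℝ) / N +
        σ * L i.castSucc) / 4) * ‖x k ω - y k ω i‖ ^ 2 + (1 + α i / 2 - lam i / 2 -
        (1 - σ) * γ * L i.castSucc / 4) * ‖x k ω - w k ω i‖ ^ 2)
        (fun j _ => hnn k j) (Finset.mem_univ i)) hterm
  have hroot : ∀ {c : ℝ} {u : ℕ → ℝ}, 0 < c → (∀ k, 0 ≤ u k) →
      Tendsto (fun k => c * u k ^ 2) atTop (𝓝 0) → Tendsto u atTop (𝓝 0) := by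
    intro c u hc hu hlim
    have h1 : Tendsto (fun k => u k ^ 2) atTop (𝓝 0) := by
      simpa [hc.ne'] using hlim.const_mul c⁻¹
    simpa [Real.sqrt_sq (hu _)] using h1.sqrt
  have hw : ∀ i, Tendsto (fun k => ‖x k ω - w k ω i‖) atTop (𝓝 0) := fun i =>
    hroot (hpar.user_coeff_pos i) (fun _ => norm_nonneg _) (squeeze_zero
      (fun k => mul_nonneg (hpar.user_coeff_pos i).le (sq_nonneg _))
      (fun k => le_add_of_nonneg_left (mul_nonneg (hpar.server_coeff_nonneg i) (sq_nonneg _)))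
      (hsq i))
  have hy : ∀ i, Tendsto (fun k => α i * ‖x k ω - y k ω i‖) atTop (𝓝 0) := fun i => by
    rcases hpar.server_coeff_pos_or i with hc | hc
    · simpa using (hroot hc (fun _ => norm_nonneg _) (squeeze_zero
        (fun k => mul_nonneg hc.le (sq_nonneg _))
        (fun k => le_add_of_nonneg_right (mul_nonneg (hpar.user_coeff_pos i).le (sq_nonneg _)))
        (hsq i))).const_mul (α i)
    · simp [hc]
  obtain ⟨xs, zs, hfix, hx⟩ := exists_isFixedPair_tendsto hN hfg hpar hS.pos (fun v hv => hD hv)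
    hDd (fun k => h.server k ω) (fun k => h.user k ω) hV hw hy
  refine ⟨⟨xs, hfix.mem_argminSet hN hfg hpar.gamma_pos, hx⟩, fun i => ?_, hw⟩
  have hwx : Tendsto (fun k => w k ω i) atTop (𝓝 xs) := by
    simpa using hx.sub (tendsto_zero_iff_norm_tendsto_zero.2 (hw i))
  have hyx : Tendsto (fun k => y k ω i) atTop (𝓝 xs) :=
    tendsto_of_frequently_refreshed hwx (fun k => by
      by_cases hi : i ∈ S k ω
      · exact Or.inr (h.active_y k ω i hi)
      · exact Or.inl (h.idle_y k ω i hi)) (hrefresh i)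
  simpa using (hx.sub hyx).norm

end IsInclusionRun

end RandomRun

/-! ### Measurable choice of the limit and conclusion -/

/-- An almost sure limit in a nonempty set has a measurable version with values in that set. -/
theorem exists_measurable_limit_mem {Ω β : Type*} [MeasurableSpace Ω] {P : Measure Ω}
    [TopologicalSpace β] [TopologicalSpace.PseudoMetrizableSpace β] [T2Space β]
    [MeasurableSpace β] [BorelSpace β] {A : Set β} (hA : A.Nonempty) {x : ℕ → Ω → β}
    (hx : ∀ k, Measurable (x k)) (hlim : ∀ᵐ ω ∂P, ∃ a ∈ A, Tendsto (fun k => x k ω) atTop (𝓝 a)) :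
    ∃ l : Ω → β, Measurable l ∧ (∀ ω, l ω ∈ A) ∧
      ∀ᵐ ω ∂P, Tendsto (fun k => x k ω) atTop (𝓝 (l ω)) := by
  classical
  obtain ⟨a, ha⟩ := hA
  obtain ⟨l, hl, hlx⟩ := measurable_limit_of_tendsto_metrizable_ae
    (fun k => (hx k).aemeasurable (μ := P)) (hlim.mono fun ω ⟨b, _, hb⟩ => ⟨b, hb⟩)
  have hmem : ∀ᵐ ω ∂P, l ω ∈ A := by
    filter_upwards [hlim, hlx] with ω ⟨b, hb, hbx⟩ hω
    rwa [tendsto_nhds_unique hω hbx]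
  -- Redefining the limit as a fixed point of $A$ on a measurable null set avoids any measurability
  -- assumption on $A$.
  obtain ⟨T, hTsub, hT, hT0⟩ := exists_measurable_superset_of_null (ae_iff.1 hmem)
  refine ⟨T.piecewise (fun _ => a) l, measurable_const.piecewise hT hl, fun ω => ?_, ?_⟩
  · by_cases hω : ω ∈ T
    · simpa [hω] using ha
    · simp only [hω, not_false_eq_true, Set.piecewise_eq_of_notMem]
      exact not_not.1 fun hn => hω (hTsub hn)
  · filter_upwards [hlx, (measure_eq_zero_iff_ae_notMem).1 hT0] with ω hω hωT
    simpa [hωT] using hω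

theorem theorem1 {n N : ℕ} (hN : 1 ≤ N)
    (f : Fin (N + 1) → EuclideanSpace ℝ (Fin n) → EReal)
    (g : Fin (N + 1) → EuclideanSpace ℝ (Fin n) → ℝ) (L : Fin (N + 1) → NNReal)
    (hfg : IsProblem f g L)
    (σ γ : ℝ) (α lam : Fin N → ℝ) (hpar : IsAdmissible L σ γ α lam)
    {Ω : Type*} [MeasurableSpace Ω] (P : Measure Ω) [IsProbabilityMeasure P]
    (S : ℕ → Ω → Finset (Fin N)) (p : Fin N → ℝ)
    (y0 z0 : Fin N → EuclideanSpace ℝ (Fin n))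
    (x : ℕ → Ω → EuclideanSpace ℝ (Fin n))
    (y z yt : ℕ → Ω → Fin N → EuclideanSpace ℝ (Fin n))
    (hrun : ∀ ω, IsSDRSM f g σ γ α lam y0 z0 (fun k => S k ω) (fun k => x k ω)
      (fun k => y k ω) (fun k => z k ω))
    (hvirt : ∀ ω, IsVirtual f g σ γ α (fun k => x k ω) (fun k => z k ω) (fun k => yt k ω))
    (hS : IsSampling P S p y z) :
    (∀ i : Fin N, ∀ᵐ ω ∂P,
      Tendsto (fun k => ‖x (k + 1) ω - y k ω i‖) atTop (𝓝 0) ∧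
      Tendsto (fun k => ‖x k ω - yt k ω i‖) atTop (𝓝 0)) ∧
    ∃ xlim : Ω → EuclideanSpace ℝ (Fin n), Measurable xlim ∧
      (∀ ω, xlim ω ∈ argminSet (objective f g)) ∧
      ∀ᵐ ω ∂P, Tendsto (fun k => x k ω) atTop (𝓝 (xlim ω)) := by
  have h := IsInclusionRun.of_isSDRSM hN hfg hpar hrun hvirt
  have hae := h.ae_tendsto hN hfg hpar hS
  refine ⟨fun i => hae.mono fun ω hω => ⟨hω.2.1 i, ?_⟩, ?_⟩
  -- Undoes the index shift; the arbitrary values at index $0$ do not affect the limit.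
  · exact (tendsto_add_atTop_iff_nat 1).1 (hω.2.2 i)
  · have hst := h.finite_range_and_measurable hN hfg hpar hS.measurable
    obtain ⟨l, hl, hlA, hlx⟩ := exists_measurable_limit_mem (x := fun k => x (k + 1))
      hfg.exists_min (fun k =>
      measurable_of_factors_through_finite_range (hst k).2 (hst k).1 fun ω ω' hω =>
        h.x_eq hN hfg hpar hω) (hae.mono fun ω hω => hω.1)
    exact ⟨l, hl, hlA, hlx.mono fun ω hω => (tendsto_add_atTop_iff_nat 1).1 hω⟩
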